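/- Work over $\mathbb{C}$. By a conic in $\mathbb{P}^3$ we mean a smooth plane conic; it is the image of a map $f=[f_0:f_1:f_2:f_3]\colon\mathbb{P}^1\to\mathbb{P}^3$, where $f_0,\dots,f_3$ are binary quadratic forms spanning the space of all binary quadratic forms, and is thereby identified with $\mathbb{P}^1$. Let $C_1,C_2\subset\mathbb{P}^3$ be conics spanning distinct planes. The edge curve $E$ of $C_1,C_2$ is the Zariski closure in $C_1\times C_2\cong\mathbb{P}^1\times\mathbb{P}^1$ of the set of pairs $(p,q)$ with $p\neq q$ for which the tangent lines $T_pC_1$ and $T_qC_2$ meet. A curve in $\mathbb{P}^1\times\mathbb{P}^1$ has bidegree $(a,b)$ if it is defined by a bihomogeneous form of degree $a$ in the coordinates of the first factor and degree $b$ in those of the second. Consider the following nine types of (reduced) curves of bidegree $(2,2)$ in $\mathbb{P}^1\times\mathbb{P}^1$, where all components named are irreducible: 1. a smooth curve; 2. an irreducible (hence rational) curve whose only singular point is a node; 3. an irreducible (hence rational) curve with a cusp; 4. $2(1,0)+2(0,1)$: the union of two distinct curves of bidegree $(1,0)$ and two distinct curves of bidegree $(0,1)$; 5. $2(1,1)$: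 the union of two curves of bidegree $(1,1)$ meeting in two distinct points; 6. $(2,1)+(0,1)$: the union of a curve of bidegree $(2,1)$ and a curve of bidegree $(0,1)$ meeting in two distinct points; 7. $(2,1)+(0,1)$: the union of a curve of bidegree $(2,1)$ and a curve of bidegree $(0,1)$ meeting in a single point (where they are tangent); 8. $(1,1)+(0,1)+(1,0)$: the union of curves of bidegrees $(1,1)$, $(0,1)$ and $(1,0)$ with no point common to all three; 9. $(1,1)+(0,1)+(1,0)$: the union of curves of bidegrees $(1,1)$, $(0,1)$ and $(1,0)$ with a point common to all three. **Theorem.** Each of these types occurs as the edge curve of some pair of conics $C_1,C_2$ lying in distinct planes, except types 3 and 4, which do not occur: no edge curve of two conics in distinct planes is an irreducible curve with a cusp, or is of type $2(1,0)+2(0,1)$. -/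

import Mathlib

namespace EdgeCurves

/-- The complex projective line, with homogeneous coordinates `[s : t]`. -/
abbrev P1 : Type := Projectivization ℂ (Fin 2 → ℂ)

/-- Complex projective three-space. -/
abbrev P3 : Type := Projectivization ℂ (Fin 4 → ℂ)

/-! ### Smooth conics in projective three-space -/

/-- A (smooth, parametrized) conic in `ℙ³`: four binary quadratic forms spanning the space
`H⁰(ℙ¹, 𝒪(2))` of all binary quadratic forms. Every smooth conic is the image of `ℙ¹` under such a
quadruple, which identifies the conic with `ℙ¹`. -/
structure Conic where
  f : Fin 4 → MvPolynomial (Fin 2) ℂ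
  isHomogeneous : ∀ i, (f i).IsHomogeneous 2
  span_eq : Submodule.span ℂ (Set.range f) = MvPolynomial.homogeneousSubmodule (Fin 2) ℂ 2

namespace Conic

/-- The value of the four quadratic forms at a vector. -/
noncomputable def vec (K : Conic) (v : Fin 2 → ℂ) : Fin 4 → ℂ :=
  fun i => MvPolynomial.eval v (K.f i)

/-- The quadratic forms have no common zero, so they define a map to `ℙ³`. -/
theorem vec_ne_zero (K : Conic) {v : Fin 2 → ℂ} (hv : v ≠ 0) : K.vec v ≠ 0 := by
  intro h
  apply hv
  have key : ∀ g ∈ Submodule.span ℂ (Set.range K.f), MvPolynomial.eval v g = 0 := by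
    intro g hg
    induction hg using Submodule.span_induction with
    | mem x hx =>
      obtain ⟨i, rfl⟩ := hx
      exact congrFun h i
    | zero => simp
    | add x y _ _ hx hy => simp [hx, hy]
    | smul a x _ hx => simp [hx]
  rw [K.span_eq] at key
  funext i
  have h2 := key ((MvPolynomial.X i) ^ 2) (by
    rw [MvPolynomial.mem_homogeneousSubmodule]
    simpa using (MvPolynomial.isHomogeneous_X ℂ i).pow 2)
  simpa using h2

/-- The parametrization `ℙ¹ → ℙ³`, whose image is the conic. -/
noncomputable def map (K : Conic) (x : P1) : P3 :=
  Projectivization.mk ℂ (K.vec x.rep) (K.vec_ne_zero x.rep_nonzero)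

/-- The plane spanned by the conic, as a linear subspace of `ℂ⁴`. -/
noncomputable def plane (K : Conic) : Submodule ℂ (Fin 4 → ℂ) :=
  Submodule.span ℂ (Set.range fun x : P1 => K.vec x.rep)

/-- The tangent line to the conic at the point with parameter `x`, as a linear subspace of `ℂ⁴`:
it is spanned by `∂f/∂s` and `∂f/∂t` evaluated at `x`. -/
noncomputable def tangentLine (K : Conic) (x : P1) : Submodule ℂ (Fin 4 → ℂ) :=
  Submodule.span ℂ (Set.range fun j : Fin 2 =>
    fun i : Fin 4 => MvPolynomial.eval x.rep (MvPolynomial.pderiv j (K.f i)))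

end Conic

/-! ### Curves in `ℙ¹ × ℙ¹` -/

/-- Polynomials in the coordinates `s, t` (left) and `u, v` (right) of `ℙ¹ × ℙ¹`. -/
abbrev BiPoly : Type := MvPolynomial (Fin 2 ⊕ Fin 2) ℂ

/-- `F` is bihomogeneous, of degree `a` in `s, t` and degree `b` in `u, v`. -/
def IsBihomogeneous (F : BiPoly) (a b : ℕ) : Prop :=
  MvPolynomial.IsWeightedHomogeneous (Sum.elim (fun _ => 1) (fun _ => 0) : Fin 2 ⊕ Fin 2 → ℕ) F a ∧
  MvPolynomial.IsWeightedHomogeneous (Sum.elim (fun _ => 0) (fun _ => 1) : Fin 2 ⊕ Fin 2 → ℕ) F b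

/-- The value of `F` at the chosen homogeneous coordinates of a point. For bihomogeneous `F`,
whether it vanishes does not depend on that choice. -/
noncomputable def evalAt (F : BiPoly) (P : P1 × P1) : ℂ :=
  MvPolynomial.eval (Sum.elim P.1.rep P.2.rep) F

/-- The zero locus of a bihomogeneous form in `ℙ¹ × ℙ¹`. -/
def zeroLocus (F : BiPoly) : Set (P1 × P1) := {P | evalAt F P = 0}

/-- The Zariski closure of a subset of `ℙ¹ × ℙ¹`. -/
def zariskiClosure (S : Set (P1 × P1)) : Set (P1 × P1) :=
  {P | ∀ (a b : ℕ) (G : BiPoly), IsBihomogeneous G a b → S ⊆ zeroLocus G → P ∈ zeroLocus G}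

/-- The pairs `(p, q)` of distinct points `p ∈ C₁`, `q ∈ C₂` that span a stationary bisecant: the
tangent lines at `p` and `q` have a common point. -/
def stationaryPairs (C₁ C₂ : Conic) : Set (P1 × P1) :=
  {P | C₁.map P.1 ≠ C₂.map P.2 ∧ C₁.tangentLine P.1 ⊓ C₂.tangentLine P.2 ≠ ⊥}

/-- The edge curve of two conics, as a subset of `ℙ¹ × ℙ¹ ≅ C₁ × C₂`. -/
def edgeCurve (C₁ C₂ : Conic) : Set (P1 × P1) := zariskiClosure (stationaryPairs C₁ C₂)

/-! ### Singularities -/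

/-- `P` is a singular point of the curve `F = 0` (Jacobian criterion). -/
def IsSingularAt (F : BiPoly) (P : P1 × P1) : Prop :=
  evalAt F P = 0 ∧ ∀ i, evalAt (MvPolynomial.pderiv i F) P = 0

/-- The equation of `F = 0` in the affine coordinates `(h, k) ↦ ([p + h p'], [q + k q'])`. -/
noncomputable def localEquation (F : BiPoly) (p p' q q' : Fin 2 → ℂ) : MvPolynomial (Fin 2) ℂ :=
  MvPolynomial.aeval
    (Sum.elim
      (fun i => MvPolynomial.C (p i) + MvPolynomial.C (p' i) * MvPolynomial.X 0)
      (fun i => MvPolynomial.C (q i) + MvPolynomial.C (q' i) * MvPolynomial.X 1)) F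

/-- `g` is a local equation of `F = 0` in an affine chart of `ℙ¹ × ℙ¹` centred at `P`. -/
def IsLocalEquationAt (F : BiPoly) (P : P1 × P1) (g : MvPolynomial (Fin 2) ℂ) : Prop :=
  ∃ p' q' : Fin 2 → ℂ, LinearIndependent ℂ ![P.1.rep, p'] ∧ LinearIndependent ℂ ![P.2.rep, q'] ∧
    g = localEquation F P.1.rep p' P.2.rep q'

/-- `P` is a node of `F = 0`: a double point with two distinct tangent directions, that is, the
local equation starts with a product of two independent linear forms. -/
def IsNodeAt (F : BiPoly) (P : P1 × P1) : Prop :=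
  ∃ g, IsLocalEquationAt F P g ∧
    g.homogeneousComponent 0 = 0 ∧ g.homogeneousComponent 1 = 0 ∧
    ∃ L M : MvPolynomial (Fin 2) ℂ, L.IsHomogeneous 1 ∧ M.IsHomogeneous 1 ∧
      LinearIndependent ℂ ![L, M] ∧ g.homogeneousComponent 2 = L * M

/-- `P` is an (ordinary) cusp of `F = 0`: a double point with exactly one tangent direction `L`,
whose tangent line meets the curve with multiplicity three at the point. -/
def IsCuspAt (F : BiPoly) (P : P1 × P1) : Prop :=
  ∃ g, IsLocalEquationAt F P g ∧
    g.homogeneousComponent 0 = 0 ∧ g.homogeneousComponent 1 = 0 ∧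
    ∃ L : MvPolynomial (Fin 2) ℂ, L.IsHomogeneous 1 ∧ L ≠ 0 ∧
      g.homogeneousComponent 2 = L ^ 2 ∧ ¬ L ∣ g.homogeneousComponent 3

/-! ### Types of curves of bidegree `(2,2)` -/

/-- `G` defines an irreducible curve of bidegree `(a, b)`. -/
def IsIrreducibleCurve (G : BiPoly) (a b : ℕ) : Prop :=
  IsBihomogeneous G a b ∧ Irreducible G

/-- The nine types of `(2,2)`-curves. -/
inductive CurveType
  /-- a smooth curve -/
  | smooth
  /-- an irreducible (rational) curve with a node -/
  | nodal
  /-- an irreducible (rational) curve with a cusp -/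
  | cuspidal
  /-- `2(1,0) + 2(0,1)` -/
  | fourLines
  /-- `2(1,1)` -/
  | twoConics
  /-- `(2,1) + (0,1)`, the components meeting in two points -/
  | cubicSecant
  /-- `(2,1) + (0,1)`, the components being tangent -/
  | cubicTangent
  /-- `(1,1) + (0,1) + (1,0)`, the components forming a triangle -/
  | triangle
  /-- `(1,1) + (0,1) + (1,0)`, the components having a common point -/
  | concurrent

/-- The form `F` of bidegree `(2,2)` defines a curve of the given type. In each case the curve is
reduced. -/
def HasType (F : BiPoly) : CurveType → Prop
  | .smooth => ∀ P, ¬ IsSingularAt F P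
  | .nodal => Irreducible F ∧ ∃ P, IsNodeAt F P ∧ ∀ Q, IsSingularAt F Q → Q = P
  | .cuspidal => Irreducible F ∧ ∃ P, IsCuspAt F P
  | .fourLines => ∃ H₁ H₂ K₁ K₂ : BiPoly,
      IsIrreducibleCurve H₁ 1 0 ∧ IsIrreducibleCurve H₂ 1 0 ∧
      IsIrreducibleCurve K₁ 0 1 ∧ IsIrreducibleCurve K₂ 0 1 ∧
      ¬ Associated H₁ H₂ ∧ ¬ Associated K₁ K₂ ∧ F = H₁ * H₂ * (K₁ * K₂)
  | .twoConics => ∃ G H : BiPoly, IsIrreducibleCurve G 1 1 ∧ IsIrreducibleCurve H 1 1 ∧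
      F = G * H ∧ (zeroLocus G ∩ zeroLocus H).encard = 2
  | .cubicSecant => ∃ G H : BiPoly, IsIrreducibleCurve G 2 1 ∧ IsIrreducibleCurve H 0 1 ∧
      F = G * H ∧ (zeroLocus G ∩ zeroLocus H).encard = 2
  | .cubicTangent => ∃ G H : BiPoly, IsIrreducibleCurve G 2 1 ∧ IsIrreducibleCurve H 0 1 ∧
      F = G * H ∧ (zeroLocus G ∩ zeroLocus H).encard = 1
  | .triangle => ∃ G H K : BiPoly,
      IsIrreducibleCurve G 1 1 ∧ IsIrreducibleCurve H 0 1 ∧ IsIrreducibleCurve K 1 0 ∧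
      F = G * H * K ∧ zeroLocus G ∩ zeroLocus H ∩ zeroLocus K = ∅
  | .concurrent => ∃ G H K : BiPoly,
      IsIrreducibleCurve G 1 1 ∧ IsIrreducibleCurve H 0 1 ∧ IsIrreducibleCurve K 1 0 ∧
      F = G * H * K ∧ (zeroLocus G ∩ zeroLocus H ∩ zeroLocus K).Nonempty

/-- The subset `E` of `ℙ¹ × ℙ¹` is a curve of bidegree `(2,2)` of the given type. -/
def IsCurveOfType (E : Set (P1 × P1)) (τ : CurveType) : Prop :=
  ∃ F : BiPoly, IsBihomogeneous F 2 2 ∧ zeroLocus F = E ∧ HasType F τ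

end EdgeCurves

namespace EdgeCurves

open MvPolynomial

/-! ### Bihomogeneous forms -/

namespace IsBihomogeneous

variable {F G : BiPoly} {a b a' b' : ℕ}

/-! In suitable coordinates `C₁` lies in `x₃ = 0` and `C₂` in `x₂ = 0`. Tangent lines in these
planes can meet only on the common line `ℓ : x₂ = x₃ = 0`. If `f` parametrizes `C₁`, its tangent at
`p` meets `ℓ` at `[a(p) : b(p)]`, where `a`, `b` are the Jacobians of `(f₀, f₂)` and `(f₁, f₂)`;
both vanish at `p` exactly when that tangent is `ℓ`. With `c`, `d` obtained likewise from `C₂`, the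
tangents meet iff `a(p) d(q) - b(p) c(q) = 0`. Each of the pairs `a, b` and `c, d` is independent.
The condition `p ≠ q` removes only points whose two coordinates are roots of fixed nonzero forms, so
no component is lost and the edge curve is this whole zero locus (`edgeCurve_eq`,
`exists_edgeForm`).

Both exclusions follow from this shape. Two distinct `(1,0)`-lines would be two common zeros of `a`
and `b`, making them proportional (`not_fourLines`). For a cusp, the `3 × 3` coefficient matrix in
any chart is a difference of two rank-one matrices, hence singular; this forces the tangent
direction of a double point with a single tangent to be a ruling direction, and then the tangent
divides the cubic part (`not_cuspidal`).

Conversely, any two invertible matrices of coefficients give such conics (`exists_conics`). The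
examples are found by viewing the curve as a fibre product of `[a : b]` and `[c : d]`: shared branch
values create singular points, and base points, where a conic touches `ℓ`, split off lines. -/

theorem mul (hF : IsBihomogeneous F a b) (hG : IsBihomogeneous G a' b') :
    IsBihomogeneous (F * G) (a + a') (b + b') :=
  ⟨hF.1.mul hG.1, hF.2.mul hG.2⟩

theorem pow (hF : IsBihomogeneous F a b) (n : ℕ) : IsBihomogeneous (F ^ n) (n * a) (n * b) :=
  ⟨by simpa using hF.1.pow n, by simpa using hF.2.pow n⟩

theorem add (hF : IsBihomogeneous F a b) (hG : IsBihomogeneous G a b) :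
    IsBihomogeneous (F + G) a b :=
  ⟨hF.1.add hG.1, hF.2.add hG.2⟩

theorem neg (hF : IsBihomogeneous F a b) : IsBihomogeneous (-F) a b :=
  ⟨hF.1.neg, hF.2.neg⟩

theorem sub (hF : IsBihomogeneous F a b) (hG : IsBihomogeneous G a b) :
    IsBihomogeneous (F - G) a b :=
  ⟨hF.1.sub hG.1, hF.2.sub hG.2⟩

theorem C_mul (hF : IsBihomogeneous F a b) (c : ℂ) : IsBihomogeneous (C c * F) a b :=
  ⟨hF.1.C_mul c, hF.2.C_mul c⟩

theorem isHomogeneous (hF : IsBihomogeneous F a b) : F.IsHomogeneous (a + b) := by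
  intro d hd
  rw [← hF.1 hd, ← hF.2 hd]
  simp [Finsupp.weight_apply, Finsupp.sum_fintype]

theorem eval_smul (hF : IsBihomogeneous F a b) (x y : ℂ) (v w : Fin 2 → ℂ) :
    eval (Sum.elim (x • v) (y • w)) F = x ^ a * y ^ b * eval (Sum.elim v w) F := by
  rw [eval_eq', eval_eq', Finset.mul_sum]
  refine Finset.sum_congr rfl fun d hd ↦ ?_
  have h1 := hF.1 (mem_support_iff.1 hd)
  have h2 := hF.2 (mem_support_iff.1 hd)
  rw [Finsupp.weight_apply, Finsupp.sum_fintype _ _ (by simp)] at h1 h2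
  simp only [Fintype.sum_sum_type, Sum.elim_inl, Sum.elim_inr, smul_eq_mul, mul_one, mul_zero,
    Finset.sum_const_zero, add_zero, zero_add] at h1 h2
  rw [← h1, ← h2]
  simp only [Fintype.prod_sum_type, Sum.elim_inl, Sum.elim_inr, Pi.smul_apply, smul_eq_mul,
    mul_pow, Finset.prod_mul_distrib, Finset.prod_pow_eq_pow_sum]
  ring

end IsBihomogeneous

theorem isBihomogeneous_inl (i : Fin 2) : IsBihomogeneous (X (Sum.inl i)) 1 0 :=
  ⟨isWeightedHomogeneous_X _ _ _, isWeightedHomogeneous_X _ _ _⟩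

theorem isBihomogeneous_inr (i : Fin 2) : IsBihomogeneous (X (Sum.inr i)) 0 1 :=
  ⟨isWeightedHomogeneous_X _ _ _, isWeightedHomogeneous_X _ _ _⟩

/-- A vanishing statement at the chosen representatives extends to all coordinate vectors. -/
theorem IsBihomogeneous.eval_eq_zero_iff {F : BiPoly} {a b : ℕ} (hF : IsBihomogeneous F a b)
    {v w : Fin 2 → ℂ} (hv : v ≠ 0) (hw : w ≠ 0) :
    eval (Sum.elim v w) F = 0 ↔
      (Projectivization.mk ℂ v hv, Projectivization.mk ℂ w hw) ∈ zeroLocus F := by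
  obtain ⟨x, hx⟩ := Projectivization.exists_smul_eq_mk_rep ℂ v hv
  obtain ⟨y, hy⟩ := Projectivization.exists_smul_eq_mk_rep ℂ w hw
  have := hF.eval_smul (x : ℂ) (y : ℂ) v w
  simp only [zeroLocus, evalAt, Set.mem_ofPred_eq, ← hx, ← hy, Units.smul_def, this]
  simp

theorem IsBihomogeneous.eval_eq_zero_of_eq_zero {F : BiPoly} {a b : ℕ}
    (hF : IsBihomogeneous F (a + 1) (b + 1)) {v w : Fin 2 → ℂ} (h : v = 0 ∨ w = 0) :
    eval (Sum.elim v w) F = 0 := by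
  rcases h with rfl | rfl
  · simpa using hF.eval_smul 0 1 0 w
  · simpa using hF.eval_smul 1 0 v 0

/-! ### Zero loci, divisibility and Zariski closure -/

/-- Passes from `ℙ¹ × ℙ¹` to affine space, where the Nullstellensatz applies. Vectors with a zero
block represent no point; the positive bidegree of `G` takes care of them. -/
theorem eval_eq_zero_of_zeroLocus_subset {F G : BiPoly} {a b a' b' : ℕ}
    (hF : IsBihomogeneous F a b) (hG : IsBihomogeneous G (a' + 1) (b' + 1))
    (h : zeroLocus F ⊆ zeroLocus G) (x : Fin 2 ⊕ Fin 2 → ℂ) (hx : eval x F = 0) :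
    eval x G = 0 := by
  obtain ⟨v, w, rfl⟩ : ∃ v w, x = Sum.elim v w := ⟨x ∘ Sum.inl, x ∘ Sum.inr, by simp⟩
  by_cases hv : v = 0
  · exact hG.eval_eq_zero_of_eq_zero (.inl hv)
  by_cases hw : w = 0
  · exact hG.eval_eq_zero_of_eq_zero (.inr hw)
  rw [hG.eval_eq_zero_iff hv hw]
  exact h ((hF.eval_eq_zero_iff hv hw).1 hx)

/-- The Nullstellensatz for an irreducible hypersurface. -/
theorem dvd_of_forall_eval_eq_zero {σ : Type*} [Finite σ] {F G : MvPolynomial σ ℂ}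
    (hF : Irreducible F) (h : ∀ x, eval x F = 0 → eval x G = 0) : F ∣ G := by
  have hp : (Ideal.span {F}).IsPrime := (Ideal.span_singleton_prime hF.ne_zero).2 hF.prime
  rw [← Ideal.mem_span_singleton, ← IsPrime.vanishingIdeal_zeroLocus (K := ℂ) (Ideal.span {F})]
  intro x hx
  refine h x ?_
  simpa [aeval_eq_eval] using hx F (Ideal.mem_span_singleton_self F)

theorem exists_irreducible_factor_eval_eq_zero {σ : Type*} {F : MvPolynomial σ ℂ}
    (hF : F ≠ 0) {x : σ → ℂ} (hx : eval x F = 0) :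
    ∃ π, Irreducible π ∧ π ∣ F ∧ eval x π = 0 := by
  obtain ⟨s, hs, hsF⟩ := UniqueFactorizationMonoid.exists_prime_factors F hF
  have h0 : eval x s.prod = 0 := by
    obtain ⟨c, hc⟩ := hsF.symm
    rw [← hc, map_mul, hx, zero_mul]
  rw [map_multiset_prod, Multiset.prod_eq_zero_iff, Multiset.mem_map] at h0
  obtain ⟨π, hπ, h0⟩ := h0
  exact ⟨π, (hs π hπ).irreducible, (Multiset.dvd_prod hπ).trans hsF.dvd, h0⟩

theorem notMem_vars_of_dvd {σ : Type*} {F G : MvPolynomial σ ℂ} (hG : G ≠ 0) (h : F ∣ G)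
    {i : σ} (hi : i ∉ G.vars) : i ∉ F.vars := by
  classical
  obtain ⟨K, rfl⟩ := h
  rw [mem_vars_iff_degreeOf_ne_zero, not_not] at *
  rw [degreeOf_mul_eq (left_ne_zero_of_mul hG) (right_ne_zero_of_mul hG)] at hi
  lia

/-- The two multiples use disjoint sets of variables, so the common divisor involves none.
Geometrically, a finite set of points contains no curve. -/
theorem isUnit_of_dvd_rename {A B : MvPolynomial (Fin 2) ℂ} (hA : A ≠ 0) (hB : B ≠ 0) {π : BiPoly}
    (h1 : π ∣ rename Sum.inl A) (h2 : π ∣ rename Sum.inr B) : IsUnit π := by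
  classical
  have hA' : rename Sum.inl A ≠ (0 : BiPoly) := by
    rwa [Ne, map_eq_zero_iff _ (rename_injective _ Sum.inl_injective)]
  have hB' : rename Sum.inr B ≠ (0 : BiPoly) := by
    rwa [Ne, map_eq_zero_iff _ (rename_injective _ Sum.inr_injective)]
  have hv : π.vars = ∅ := by
    refine Finset.eq_empty_of_forall_notMem ?_
    rintro (i | i)
    · refine notMem_vars_of_dvd hB' h2 fun hi ↦ ?_
      simpa using vars_rename _ _ hi
    · refine notMem_vars_of_dvd hA' h1 fun hi ↦ ?_
      simpa using vars_rename _ _ hi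
  rw [vars_eq_empty_iff_eq_C] at hv
  have h0 := ne_zero_of_dvd_ne_zero hA' h1
  rw [hv, Ne, C_eq_zero] at h0
  rw [hv]
  exact (isUnit_iff_ne_zero.2 h0).map C

/-- Removing from a curve points `(p, q)` with `A(p) = B(q) = 0` does not change its Zariski
closure. -/
theorem zariskiClosure_eq_zeroLocus {F : BiPoly} {m n : ℕ} (hF : IsBihomogeneous F m n)
    (hF0 : F ≠ 0) {S : Set (P1 × P1)} (hS : S ⊆ zeroLocus F)
    {A B : MvPolynomial (Fin 2) ℂ} {k l : ℕ} (hA : A ≠ 0) (hB : B ≠ 0)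
    (hA' : IsBihomogeneous (rename Sum.inl A) k 0) (hB' : IsBihomogeneous (rename Sum.inr B) 0 l)
    (h : ∀ P ∈ zeroLocus F, P ∉ S → eval P.1.rep A = 0 ∧ eval P.2.rep B = 0) :
    zariskiClosure S = zeroLocus F := by
  refine Set.Subset.antisymm (fun P hP ↦ hP _ _ F hF hS) fun P hP a b G hG hSG ↦ ?_
  obtain ⟨i, hi⟩ := Function.ne_iff.1 P.1.rep_nonzero
  obtain ⟨j, hj⟩ := Function.ne_iff.1 P.2.rep_nonzero
  obtain ⟨π, hπ, hπF, hπP⟩ := exists_irreducible_factor_eval_eq_zero hF0 hP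
  -- The two coordinates are nonzero at `P`, so they do not affect vanishing there, and they make
  -- both degrees positive.
  set T : BiPoly := X (Sum.inl i) * X (Sum.inr j) * G with hT
  have hTh : IsBihomogeneous T (a + 1) (b + 1) := by
    have := ((isBihomogeneous_inl i).mul (isBihomogeneous_inr j)).mul hG
    rwa [add_comm a, add_comm b]
  -- `T * g` vanishes on all of `F = 0`: on `S` because `G` does, off `S` because `g` does. It is
  -- applied to `g = A(p)` and `g = B(q)`.
  have key : ∀ (g : BiPoly) (a' b' : ℕ), IsBihomogeneous g a' b' →
      (∀ Q ∈ zeroLocus F, Q ∉ S → evalAt g Q = 0) → π ∣ T * g := by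
    intro g a' b' hg hgS
    refine dvd_of_forall_eval_eq_zero hπ fun x hx ↦ ?_
    refine eval_eq_zero_of_zeroLocus_subset (a' := a + a') (b' := b + b') hF ?_ ?_ x ?_
    · convert! hTh.mul hg using 1 <;> ring
    · intro Q hQ
      by_cases hQS : Q ∈ S
      · have : evalAt G Q = 0 := hSG hQS
        simp only [evalAt] at this
        simp [zeroLocus, evalAt, hT, this]
      · have := hgS Q hQ hQS
        simp only [evalAt] at this
        simp [zeroLocus, evalAt, this]
    · obtain ⟨c, rfl⟩ := hπF
      simp [hx]
  have hTP : π ∣ T := by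
    by_contra hn
    have h1 := key _ _ _ hA' fun Q hQ hQS ↦ by
      simpa [evalAt, eval_rename] using (h Q hQ hQS).1
    have h2 := key _ _ _ hB' fun Q hQ hQS ↦ by
      simpa [evalAt, eval_rename] using (h Q hQ hQS).2
    exact hπ.not_isUnit (isUnit_of_dvd_rename hA hB ((hπ.prime.dvd_or_dvd h1).resolve_left hn)
      ((hπ.prime.dvd_or_dvd h2).resolve_left hn))
  obtain ⟨c, hc⟩ := hTP
  have := congrArg (eval (Sum.elim P.1.rep P.2.rep)) hc
  simp only [hT, map_mul, eval_X, Sum.elim_inl, Sum.elim_inr, hπP, zero_mul, mul_eq_zero] at this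
  exact (this.resolve_left (not_or.2 ⟨hi, hj⟩))

/-! ### Binary quadratic forms -/

/-- The binary quadratic form with coefficients `q`. -/
noncomputable def quad : (Fin 3 → ℂ) →ₗ[ℂ] MvPolynomial (Fin 2) ℂ where
  toFun q := C (q 0) * X 0 ^ 2 + C (q 1) * (X 0 * X 1) + C (q 2) * X 1 ^ 2
  map_add' p q := by simp only [Pi.add_apply, C_add]; ring
  map_smul' r q := by simp only [Pi.smul_apply, smul_eq_mul, C_mul, smul_eq_C_mul,
    RingHom.id_apply]; ring

theorem quad_apply (q : Fin 3 → ℂ) :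
    quad q = C (q 0) * X 0 ^ 2 + C (q 1) * (X 0 * X 1) + C (q 2) * X 1 ^ 2 := rfl

theorem eval_quad (q : Fin 3 → ℂ) (v : Fin 2 → ℂ) :
    eval v (quad q) = q 0 * v 0 ^ 2 + q 1 * (v 0 * v 1) + q 2 * v 1 ^ 2 := by
  simp [quad_apply]

theorem quad_isHomogeneous (q : Fin 3 → ℂ) : (quad q).IsHomogeneous 2 := by
  refine (IsHomogeneous.add ?_ ?_).add ?_
  · exact ((isHomogeneous_X ℂ 0).pow 2).C_mul _
  · exact ((isHomogeneous_X ℂ 0).mul (isHomogeneous_X ℂ 1)).C_mul _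
  · exact ((isHomogeneous_X ℂ 1).pow 2).C_mul _

theorem coeffs_eq_zero_of_forall_eval_quad {q : Fin 3 → ℂ} (h : ∀ v, eval v (quad q) = 0) :
    q = 0 := by
  have h1 := h ![1, 0]
  have h2 := h ![0, 1]
  have h3 := h ![1, 1]
  simp only [eval_quad, Matrix.cons_val_zero, Matrix.cons_val_one] at h1 h2 h3
  ext i
  fin_cases i
  · simpa using h1
  · simp at h1 h2 h3 ⊢; linear_combination h3 - h1 - h2
  · simpa using h2

theorem quad_injective : Function.Injective quad := by
  rw [← LinearMap.ker_eq_bot, LinearMap.ker_eq_bot']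
  exact fun q hq ↦ coeffs_eq_zero_of_forall_eval_quad fun v ↦ by rw [hq, map_zero]

theorem exists_eq_quad {p : MvPolynomial (Fin 2) ℂ} (hp : p.IsHomogeneous 2) :
    ∃ q, quad q = p := by
  classical
  refine ⟨![p.coeff (Finsupp.single 0 2), p.coeff (Finsupp.single 0 1 + Finsupp.single 1 1),
    p.coeff (Finsupp.single 1 2)], ?_⟩
  ext d
  by_cases hd : d.degree = 2
  · have hd' : d 0 + d 1 = 2 := by simpa [Finsupp.degree_eq_sum] using hd
    have hX : (X 0 * X 1 : MvPolynomial (Fin 2) ℂ) =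
        monomial (Finsupp.single 0 1 + Finsupp.single 1 1) 1 := by
      simp [X, monomial_mul]
    rw [quad_apply, hX, X_pow_eq_monomial, X_pow_eq_monomial]
    simp only [coeff_add, coeff_C_mul, coeff_monomial, mul_ite, mul_one, mul_zero]
    have : d 0 = 0 ∨ d 0 = 1 ∨ d 0 = 2 := by lia
    have hs : d = Finsupp.single 0 (d 0) + Finsupp.single 1 (d 1) := by
      ext i; fin_cases i <;> simp
    rcases this with h | h | h
    · have h1 : d 1 = 2 := by lia
      rw [h, h1, Finsupp.single_zero, zero_add] at hs
      subst hs
      simp [Finsupp.ext_iff, Fin.forall_fin_two]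
    · have h1 : d 1 = 1 := by lia
      rw [h, h1] at hs
      subst hs
      simp [Finsupp.ext_iff, Fin.forall_fin_two]
    · have h1 : d 1 = 0 := by lia
      rw [h, h1, Finsupp.single_zero, add_zero] at hs
      subst hs
      simp [Finsupp.ext_iff, Fin.forall_fin_two]
  · rw [hp.coeff_eq_zero hd, (quad_isHomogeneous _).coeff_eq_zero hd]

theorem range_quad : LinearMap.range quad = homogeneousSubmodule (Fin 2) ℂ 2 := by
  ext p
  rw [mem_homogeneousSubmodule, LinearMap.mem_range]
  exact ⟨fun ⟨q, hq⟩ ↦ hq ▸ quad_isHomogeneous q, exists_eq_quad⟩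

/-- Half the coefficients of the Jacobian determinant of two binary quadratic forms. -/
def jac (x y : Fin 3 → ℂ) : Fin 3 → ℂ :=
  ![x 0 * y 1 - x 1 * y 0, 2 * (x 0 * y 2 - x 2 * y 0), x 1 * y 2 - x 2 * y 1]

/-- Up to order, signs and a factor 2, `jac x y` is the cross product. Pairing `(s T₀ + t T₁) × T₂`
with `T₁` or `T₀` isolates `s` or `t` times the determinant. -/
theorem linearIndependent_jac {T : Matrix (Fin 3) (Fin 3) ℂ} (hT : T.det ≠ 0) :
    LinearIndependent ℂ ![jac (T 0) (T 2), jac (T 1) (T 2)] := by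
  rw [LinearIndependent.pair_iff]
  intro s t h
  have h0 := congrFun h 0
  have h1 := congrFun h 1
  have h2 := congrFun h 2
  simp only [jac, Pi.add_apply, Pi.smul_apply, smul_eq_mul, Matrix.cons_val_zero,
    Matrix.cons_val_one, Matrix.cons_val, Pi.zero_apply] at h0 h1 h2
  rw [Matrix.det_fin_three] at hT
  constructor <;> refine (mul_eq_zero.1 ?_).resolve_right hT
  · linear_combination (-T 1 2) * h0 + (T 1 1 / 2) * h1 - T 1 0 * h2
  · linear_combination (T 0 2) * h0 - (T 0 1 / 2) * h1 + T 0 0 * h2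

/-- The form `a(p) d(q) - b(p) c(q)` of bidegree `(2,2)`. -/
noncomputable def edgeForm (a b c d : Fin 3 → ℂ) : BiPoly :=
  rename Sum.inl (quad a) * rename Sum.inr (quad d) -
    rename Sum.inl (quad b) * rename Sum.inr (quad c)

theorem eval_edgeForm (a b c d : Fin 3 → ℂ) (v w : Fin 2 → ℂ) :
    eval (Sum.elim v w) (edgeForm a b c d) =
      eval v (quad a) * eval w (quad d) - eval v (quad b) * eval w (quad c) := by
  simp [edgeForm, eval_rename]

theorem isBihomogeneous_quad_inl (q : Fin 3 → ℂ) :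
    IsBihomogeneous (rename Sum.inl (quad q)) 2 0 := by
  simp only [quad_apply, map_add, map_mul, rename_C, map_pow, rename_X]
  exact ((((isBihomogeneous_inl 0).pow 2).C_mul _).add
    (((isBihomogeneous_inl 0).mul (isBihomogeneous_inl 1)).C_mul _)).add
    (((isBihomogeneous_inl 1).pow 2).C_mul _)

theorem isBihomogeneous_quad_inr (q : Fin 3 → ℂ) :
    IsBihomogeneous (rename Sum.inr (quad q)) 0 2 := by
  simp only [quad_apply, map_add, map_mul, rename_C, map_pow, rename_X]
  exact ((((isBihomogeneous_inr 0).pow 2).C_mul _).add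
    (((isBihomogeneous_inr 0).mul (isBihomogeneous_inr 1)).C_mul _)).add
    (((isBihomogeneous_inr 1).pow 2).C_mul _)

theorem isBihomogeneous_edgeForm (a b c d : Fin 3 → ℂ) :
    IsBihomogeneous (edgeForm a b c d) 2 2 :=
  ((isBihomogeneous_quad_inl a).mul (isBihomogeneous_quad_inr d)).sub
    ((isBihomogeneous_quad_inl b).mul (isBihomogeneous_quad_inr c))

/-- Two independent forms have no constant linear relation `x d = y c`. -/
theorem eq_zero_of_forall_eval {c d : Fin 3 → ℂ} (h : LinearIndependent ℂ ![c, d]) {x y : ℂ}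
    (hxy : ∀ w, x * eval w (quad d) - y * eval w (quad c) = 0) : x = 0 ∧ y = 0 := by
  have : -y • c + x • d = 0 := coeffs_eq_zero_of_forall_eval_quad fun w ↦ by
    rw [map_add, map_smul, map_smul, map_add, smul_eval, smul_eval]
    linear_combination hxy w
  have := LinearIndependent.pair_iff.1 h _ _ this
  simpa using this.symm

/-- For fixed `p` a vanishing form is a linear relation between `c` and `d`, so `a(p) = 0` for every
`p`. -/
theorem edgeForm_ne_zero {a b c d : Fin 3 → ℂ} (h₁ : LinearIndependent ℂ ![a, b])
    (h₂ : LinearIndependent ℂ ![c, d]) : edgeForm a b c d ≠ 0 := by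
  intro h
  have ha : a = 0 := coeffs_eq_zero_of_forall_eval_quad fun v ↦
    (eq_zero_of_forall_eval h₂ (y := eval v (quad b)) fun w ↦ by
      rw [← eval_edgeForm, h, map_zero]).1
  simpa [ha] using h₁.ne_zero 0

/-! ### Conics and matrices -/

/-- The conic whose quadratic forms have the rows of `A` as coefficients. -/
noncomputable def conicOfRows (A : Fin 4 → Fin 3 → ℂ) (h : Submodule.span ℂ (Set.range A) = ⊤) :
    Conic where
  f i := quad (A i)
  isHomogeneous i := quad_isHomogeneous _
  span_eq := by
    have : (Set.range fun i ↦ quad (A i)) = quad '' Set.range A := by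
      rw [← Set.range_comp]; rfl
    rw [this, ← Submodule.map_span, h, Submodule.map_top, range_quad]

namespace Conic

variable {K : Conic} {A : Matrix (Fin 4) (Fin 3) ℂ}

/-- The rows of `A` are the coefficients of the quadratic forms of `K`. -/
def HasMatrix (K : Conic) (A : Matrix (Fin 4) (Fin 3) ℂ) : Prop := ∀ i, K.f i = quad (A i)

theorem exists_hasMatrix (K : Conic) : ∃ A, K.HasMatrix A := by
  choose A hA using fun i ↦ exists_eq_quad (K.isHomogeneous i)
  exact ⟨A, fun i ↦ (hA i).symm⟩

theorem HasMatrix.span_eq_top (h : K.HasMatrix A) :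
    Submodule.span ℂ (Set.range A) = ⊤ := by
  apply Submodule.map_injective_of_injective quad_injective
  rw [Submodule.map_span, Submodule.map_top, range_quad, ← K.span_eq]
  congr 1
  ext p
  constructor
  · rintro ⟨_, ⟨i, rfl⟩, rfl⟩
    exact ⟨i, h i⟩
  · rintro ⟨i, rfl⟩
    exact ⟨_, ⟨i, rfl⟩, (h i).symm⟩

/-- The values of the monomials of degree two. -/
def monomials (v : Fin 2 → ℂ) : Fin 3 → ℂ := ![v 0 ^ 2, v 0 * v 1, v 1 ^ 2]

/-- The derivatives of the monomials of degree two. -/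
def dmonomials (v : Fin 2 → ℂ) : Fin 2 → Fin 3 → ℂ := ![![2 * v 0, v 1, 0], ![0, v 0, 2 * v 1]]

theorem HasMatrix.vec_eq (h : K.HasMatrix A) (v : Fin 2 → ℂ) :
    K.vec v = A.mulVec (monomials v) := by
  ext i
  simp only [vec, h i, eval_quad, Matrix.mulVec, dotProduct, Fin.sum_univ_three, monomials]
  simp

theorem HasMatrix.tangentLine_eq (h : K.HasMatrix A) (x : P1) :
    K.tangentLine x =
      Submodule.span ℂ (Set.range fun j ↦ A.mulVec (dmonomials x.rep j)) := by
  unfold tangentLine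
  congr 2
  ext j i
  simp only [h i, quad_apply, Matrix.mulVec, dotProduct, Fin.sum_univ_three]
  fin_cases j <;> simp [dmonomials, pderiv_X]

end Conic

/-! ### Linear algebra of tangent lines -/

theorem mulVec_injective_of_span_eq_top {A : Matrix (Fin 4) (Fin 3) ℂ}
    (h : Submodule.span ℂ (Set.range A) = ⊤) : Function.Injective A.mulVec := by
  intro x y hxy
  have key : ∀ r : Fin 3 → ℂ, r ⬝ᵥ (x - y) = 0 := by
    intro r
    have hr : r ∈ Submodule.span ℂ (Set.range A) := h ▸ Submodule.mem_top
    induction hr using Submodule.span_induction with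
    | mem r hr =>
      obtain ⟨i, rfl⟩ := hr
      have := congrFun hxy i
      rw [dotProduct_sub]
      exact sub_eq_zero.2 this
    | zero => simp
    | add r s _ _ hr hs => rw [add_dotProduct, hr, hs, add_zero]
    | smul c r _ hr => rw [smul_dotProduct, hr, smul_zero]
  exact sub_eq_zero.1 (dotProduct_eq_zero _ fun w ↦ by rw [dotProduct_comm]; exact key w)

theorem span_range_mul_eq_top {A : Matrix (Fin 4) (Fin 3) ℂ}
    (h : Submodule.span ℂ (Set.range A) = ⊤) {M : Matrix (Fin 4) (Fin 4) ℂ} (hM : M.det ≠ 0) :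
    Submodule.span ℂ (Set.range (M * A)) = ⊤ := by
  rw [eq_top_iff, ← h, Submodule.span_le]
  rintro _ ⟨i, rfl⟩
  have hA : M⁻¹ * (M * A) = A := by
    rw [← Matrix.mul_assoc, Matrix.nonsing_inv_mul _ (isUnit_iff_ne_zero.2 hM), Matrix.one_mul]
  have : A i = ∑ j, M⁻¹ i j • (M * A) j := by
    conv_lhs => rw [← hA]
    ext k
    simp [Matrix.mul_apply]
  rw [this]
  exact Submodule.sum_mem _ fun j _ ↦ Submodule.smul_mem _ _ (Submodule.subset_span ⟨j, rfl⟩)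

theorem linearIndependent_dmonomials {v : Fin 2 → ℂ} (hv : v ≠ 0) :
    LinearIndependent ℂ (Conic.dmonomials v) := by
  have : Conic.dmonomials v = ![![2 * v 0, v 1, 0], ![0, v 0, 2 * v 1]] := rfl
  rw [this, LinearIndependent.pair_iff]
  intro s t h
  have h0 := congrFun h 0
  have h1 := congrFun h 1
  have h2 := congrFun h 2
  simp at h0 h1 h2
  by_cases hv0 : v 0 = 0
  · have hv1 : v 1 ≠ 0 := fun hv1 ↦ hv (by ext i; fin_cases i <;> assumption)
    simp_all
  · simp_all

theorem span_inf_span_eq_bot_iff {x y : Fin 2 → Fin 4 → ℂ} (hx : LinearIndependent ℂ x)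
    (hy : LinearIndependent ℂ y) :
    Submodule.span ℂ (Set.range x) ⊓ Submodule.span ℂ (Set.range y) = ⊥ ↔
      (Matrix.of ![x 0, x 1, y 0, y 1]).det ≠ 0 := by
  rw [← isUnit_iff_ne_zero, ← Matrix.isUnit_iff_isUnit_det,
    ← Matrix.linearIndependent_rows_iff_isUnit, ← linearIndependent_equiv
      (finSumFinEquiv (m := 2) (n := 2)), linearIndependent_sum, ← disjoint_iff]
  have h1 : (Matrix.of ![x 0, x 1, y 0, y 1]).row ∘ (finSumFinEquiv (m := 2) (n := 2)) ∘
      Sum.inl = x := by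
    ext i j; fin_cases i <;> rfl
  have h2 : (Matrix.of ![x 0, x 1, y 0, y 1]).row ∘ (finSumFinEquiv (m := 2) (n := 2)) ∘
      Sum.inr = y := by
    ext i j; fin_cases i <;> rfl
  rw [Function.comp_assoc, Function.comp_assoc, h1, h2]
  simp [hx, hy]

/-- The combination `∂ₜf₂ · ∂ₛf - ∂ₛf₂ · ∂ₜf` of tangent vectors lies on `x₂ = x₃ = 0`, with
coordinates twice the `jac` forms. The same holds for the second conic with `f₃`; the two factors 2
give the 4. -/
theorem det_dmonomials {A B : Matrix (Fin 4) (Fin 3) ℂ} (hA : A 3 = 0) (hB : B 2 = 0)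
    (v w : Fin 2 → ℂ) :
    (Matrix.of ![A.mulVec (Conic.dmonomials v 0), A.mulVec (Conic.dmonomials v 1),
      B.mulVec (Conic.dmonomials w 0), B.mulVec (Conic.dmonomials w 1)]).det =
    -4 * eval (Sum.elim v w) (edgeForm (jac (A 0) (A 2)) (jac (A 1) (A 2))
      (jac (B 0) (B 3)) (jac (B 1) (B 3))) := by
  have hA' : ∀ j, A 3 j = 0 := fun j ↦ congrFun hA j
  have hB' : ∀ j, B 2 j = 0 := fun j ↦ congrFun hB j
  rw [eval_edgeForm]
  simp only [eval_quad]
  simp [Matrix.det_succ_row_zero, Fin.sum_univ_succ, Matrix.mulVec, dotProduct,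
    Conic.dmonomials, jac, hA', hB', Fin.succAbove]
  ring

/-! ### The equation of the edge curve -/

theorem mem_stationaryPairs_iff {C₁ C₂ : Conic} {A B : Matrix (Fin 4) (Fin 3) ℂ}
    (hA : C₁.HasMatrix A) (hB : C₂.HasMatrix B) {M : Matrix (Fin 4) (Fin 4) ℂ} (hM : M.det ≠ 0)
    (h₁ : (M * A) 3 = 0) (h₂ : (M * B) 2 = 0) (P : P1 × P1) :
    P ∈ stationaryPairs C₁ C₂ ↔ C₁.map P.1 ≠ C₂.map P.2 ∧
      P ∈ zeroLocus (edgeForm (jac ((M * A) 0) ((M * A) 2)) (jac ((M * A) 1) ((M * A) 2))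
        (jac ((M * B) 0) ((M * B) 3)) (jac ((M * B) 1) ((M * B) 3))) := by
  have hLI : ∀ {K : Conic} {A : Matrix (Fin 4) (Fin 3) ℂ}, K.HasMatrix A → ∀ x : P1,
      LinearIndependent ℂ fun j ↦ A.mulVec (Conic.dmonomials x.rep j) := fun hA x ↦
    (linearIndependent_dmonomials x.rep_nonzero).map_injOn (Matrix.mulVecLin _)
      (mulVec_injective_of_span_eq_top hA.span_eq_top).injOn
  have h4 := det_dmonomials h₁ h₂ P.1.rep P.2.rep
  -- The tangent vectors are rows, so the change of coordinates `M` acts on the right by its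
  -- transpose.
  have hmul : (Matrix.of ![(M * A).mulVec (Conic.dmonomials P.1.rep 0),
      (M * A).mulVec (Conic.dmonomials P.1.rep 1), (M * B).mulVec (Conic.dmonomials P.2.rep 0),
      (M * B).mulVec (Conic.dmonomials P.2.rep 1)]) =
      (Matrix.of ![A.mulVec (Conic.dmonomials P.1.rep 0), A.mulVec (Conic.dmonomials P.1.rep 1),
      B.mulVec (Conic.dmonomials P.2.rep 0), B.mulVec (Conic.dmonomials P.2.rep 1)]) *
        M.transpose := by
    simp only [← Matrix.mulVec_mulVec]
    ext i j
    have key : ∀ y : Fin 4 → ℂ, M.mulVec y j = ∑ k, y k * M j k := by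
      simp [Matrix.mulVec, dotProduct, mul_comm]
    fin_cases i <;> exact key _
  rw [hmul, Matrix.det_mul, Matrix.det_transpose] at h4
  rw [stationaryPairs, Set.mem_ofPred_eq, hA.tangentLine_eq, hB.tangentLine_eq]
  refine and_congr_right fun _ ↦
    (span_inf_span_eq_bot_iff (hLI hA P.1) (hLI hB P.2)).not.trans ?_
  rw [not_not, ← mul_eq_zero_iff_right hM, h4]
  simp [zeroLocus, evalAt]

theorem det_succAbove_ne_zero {A : Matrix (Fin 4) (Fin 3) ℂ}
    (h : Submodule.span ℂ (Set.range A) = ⊤) (i : Fin 4) (hi : A i = 0) :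
    (Matrix.of fun j : Fin 3 ↦ A (i.succAbove j)).det ≠ 0 := by
  rw [← isUnit_iff_ne_zero, ← Matrix.isUnit_iff_isUnit_det,
    ← Matrix.linearIndependent_rows_iff_isUnit]
  refine linearIndependent_of_top_le_span_of_card_eq_finrank ?_ (by simp)
  rw [← h, Submodule.span_le]
  rintro _ ⟨k, rfl⟩
  rcases Fin.eq_self_or_eq_succAbove i k with rfl | ⟨j, rfl⟩
  · exact hi ▸ Submodule.zero_mem _
  · exact Submodule.subset_span ⟨j, rfl⟩

/-- Only pairs mapping to the same point of `ℙ³` can be missing from the stationary pairs. Such a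
point lies in both planes, so coordinate 2 of the first conic vanishes at `p` and coordinate 3 of
the second at `q`; both are nonzero forms. -/
theorem edgeCurve_eq {C₁ C₂ : Conic} {A B : Matrix (Fin 4) (Fin 3) ℂ}
    (hA : C₁.HasMatrix A) (hB : C₂.HasMatrix B) {M : Matrix (Fin 4) (Fin 4) ℂ} (hM : M.det ≠ 0)
    (h₁ : (M * A) 3 = 0) (h₂ : (M * B) 2 = 0) :
    LinearIndependent ℂ ![jac ((M * A) 0) ((M * A) 2), jac ((M * A) 1) ((M * A) 2)] ∧
    LinearIndependent ℂ ![jac ((M * B) 0) ((M * B) 3), jac ((M * B) 1) ((M * B) 3)] ∧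
    edgeCurve C₁ C₂ =
      zeroLocus (edgeForm (jac ((M * A) 0) ((M * A) 2)) (jac ((M * A) 1) ((M * A) 2))
        (jac ((M * B) 0) ((M * B) 3)) (jac ((M * B) 1) ((M * B) 3))) := by
  have hdA := det_succAbove_ne_zero (span_range_mul_eq_top hA.span_eq_top hM) 3 h₁
  have hdB := det_succAbove_ne_zero (span_range_mul_eq_top hB.span_eq_top hM) 2 h₂
  have hLA := linearIndependent_jac hdA
  have hLB := linearIndependent_jac hdB
  have hA2 : (M * A) 2 ≠ 0 := fun h ↦ hdA (Matrix.det_eq_zero_of_row_eq_zero 2 (congrFun h))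
  have hB3 : (M * B) 3 ≠ 0 := fun h ↦ hdB (Matrix.det_eq_zero_of_row_eq_zero 2 (congrFun h))
  refine ⟨hLA, hLB, ?_⟩
  have hev : ∀ (A : Matrix (Fin 4) (Fin 3) ℂ) (i : Fin 4) (v : Fin 2 → ℂ),
      eval v (quad ((M * A) i)) = M.mulVec (A.mulVec (Conic.monomials v)) i := by
    intro A i v
    rw [Matrix.mulVec_mulVec, eval_quad]
    simp [Matrix.mulVec, dotProduct, Fin.sum_univ_three, Conic.monomials]
  refine zariskiClosure_eq_zeroLocus (A := quad ((M * A) 2)) (B := quad ((M * B) 3))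
    (isBihomogeneous_edgeForm _ _ _ _)
    (edgeForm_ne_zero hLA hLB)
    (fun P hP ↦ ((mem_stationaryPairs_iff hA hB hM h₁ h₂ P).1 hP).2)
    ((map_ne_zero_iff quad quad_injective).2 hA2) ((map_ne_zero_iff quad quad_injective).2 hB3)
    (isBihomogeneous_quad_inl _) (isBihomogeneous_quad_inr _) fun P hP hPS ↦ ?_
  have hmap : C₁.map P.1 = C₂.map P.2 := by
    by_contra hne
    exact hPS ((mem_stationaryPairs_iff hA hB hM h₁ h₂ P).2 ⟨hne, hP⟩)
  obtain ⟨c, hc⟩ := (Projectivization.mk_eq_mk_iff _ _ _ _ _).1 hmap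
  have hc' : ∀ i, (c : ℂ) * eval P.2.rep (quad ((M * B) i)) = eval P.1.rep (quad ((M * A) i)) := by
    intro i
    rw [hev, hev, ← hA.vec_eq, ← hB.vec_eq, ← hc, Units.smul_def, Matrix.mulVec_smul]
    rfl
  constructor
  · rw [← hc', h₂, map_zero, map_zero, mul_zero]
  · have := hc' 3
    rw [h₁, map_zero, map_zero] at this
    exact (mul_eq_zero.1 this).resolve_left c.ne_zero

/-! ### Planes of conics and the choice of coordinates -/

theorem monomials_smul (c : ℂ) (v : Fin 2 → ℂ) :
    Conic.monomials (c • v) = c ^ 2 • Conic.monomials v := by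
  ext i
  fin_cases i <;> simp [Conic.monomials] <;> ring

theorem span_monomials : Submodule.span ℂ (Set.range fun x : P1 ↦ Conic.monomials x.rep) = ⊤ := by
  have key : ∀ v : Fin 2 → ℂ, v ≠ 0 → Conic.monomials v ∈
      Submodule.span ℂ (Set.range fun x : P1 ↦ Conic.monomials x.rep) := by
    intro v hv
    obtain ⟨c, hc⟩ := Projectivization.exists_smul_eq_mk_rep ℂ v hv
    have : v = (c : ℂ)⁻¹ • (Projectivization.mk ℂ v hv).rep := by
      rw [← hc, Units.smul_def, inv_smul_smul₀ c.ne_zero]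
    rw [this, monomials_smul]
    exact Submodule.smul_mem _ _ (Submodule.subset_span ⟨_, rfl⟩)
  rw [eq_top_iff]
  intro x _
  have h : x = (x 0 - x 1) • Conic.monomials ![1, 0] + x 1 • Conic.monomials ![1, 1] +
      (x 2 - x 1) • Conic.monomials ![0, 1] := by
    ext i
    fin_cases i <;> simp [Conic.monomials]
  rw [h]
  exact Submodule.add_mem _ (Submodule.add_mem _ (Submodule.smul_mem _ _ (key _ (by simp)))
    (Submodule.smul_mem _ _ (key _ (by simp)))) (Submodule.smul_mem _ _ (key _ (by simp)))

theorem Conic.HasMatrix.plane_eq {K : Conic} {A : Matrix (Fin 4) (Fin 3) ℂ}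
    (h : K.HasMatrix A) : K.plane = LinearMap.range A.mulVecLin := by
  rw [← Submodule.map_top, ← span_monomials, Submodule.map_span, ← Set.range_comp, plane]
  congr 2
  ext x : 1
  exact h.vec_eq _

/-- Four rows in a three-dimensional space satisfy a linear relation `c`, which is the equation of
the plane; both sides have dimension 3. -/
theorem Conic.HasMatrix.exists_plane_eq_ker {K : Conic} {A : Matrix (Fin 4) (Fin 3) ℂ}
    (h : K.HasMatrix A) : ∃ c : Fin 4 → ℂ, c ≠ 0 ∧ Matrix.vecMul c A = 0 ∧
      K.plane = LinearMap.ker (dotProductBilin ℂ ℂ c) := by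
  obtain ⟨c, hc, hcA⟩ : ∃ c : Fin 4 → ℂ, c ≠ 0 ∧ Matrix.vecMul c A = 0 := by
    by_contra! hcon
    have hinj : Function.Injective A.vecMulLinear := by
      rw [← LinearMap.ker_eq_bot, LinearMap.ker_eq_bot']
      intro c hc
      by_contra h0
      exact hcon c h0 hc
    have := LinearMap.finrank_le_finrank_of_injective hinj
    simp at this
  refine ⟨c, hc, hcA, ?_⟩
  rw [h.plane_eq]
  have hc' : dotProductBilin ℂ ℂ c ≠ 0 := by
    intro h0
    exact hc (dotProduct_eq_zero _ fun w ↦ DFunLike.congr_fun h0 w)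
  have h1 := Module.Dual.finrank_ker_add_one_of_ne_zero (K := ℂ) hc'
  have h2 := LinearMap.finrank_range_of_inj (f := A.mulVecLin)
    (mulVec_injective_of_span_eq_top h.span_eq_top)
  rw [Module.finrank_fin_fun] at h1 h2
  refine Submodule.eq_of_le_of_finrank_eq ?_ (by lia)
  rintro _ ⟨x, rfl⟩
  change c ⬝ᵥ A.mulVec x = 0
  rw [Matrix.dotProduct_mulVec, hcA, zero_dotProduct]

theorem exists_normalizing_matrix {C₁ C₂ : Conic} {A B : Matrix (Fin 4) (Fin 3) ℂ}
    (hA : C₁.HasMatrix A) (hB : C₂.HasMatrix B) (h : C₁.plane ≠ C₂.plane) :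
    ∃ M : Matrix (Fin 4) (Fin 4) ℂ, M.det ≠ 0 ∧ (M * A) 3 = 0 ∧ (M * B) 2 = 0 := by
  obtain ⟨c, hc, hcA, hcp⟩ := hA.exists_plane_eq_ker
  obtain ⟨d, hd, hdB, hdp⟩ := hB.exists_plane_eq_ker
  have hLI : LinearIndependent ℂ ![d, c] := by
    rw [LinearIndependent.pair_iff' hd]
    rintro a rfl
    have ha : a ≠ 0 := left_ne_zero_of_smul hc
    refine h ?_
    rw [hcp, hdp]
    ext x
    simp [ha]
  obtain ⟨x, hx⟩ := exists_linearIndependent_cons_of_lt_finrank hLI (by simp)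
  obtain ⟨y, hy⟩ := exists_linearIndependent_cons_of_lt_finrank hx (by simp)
  -- The plane equations become the last two coordinates: `d` (second conic) is row 2 and `c` (first
  -- conic) is row 3.
  refine ⟨Matrix.of ![y, x, d, c], ?_, ?_, ?_⟩
  · rw [← isUnit_iff_ne_zero, ← Matrix.isUnit_iff_isUnit_det,
      ← Matrix.linearIndependent_rows_iff_isUnit]
    exact hy
  · exact hcA
  · exact hdB

theorem exists_edgeForm (C₁ C₂ : Conic) (h : C₁.plane ≠ C₂.plane) : ∃ a b c d : Fin 3 → ℂ,
    LinearIndependent ℂ ![a, b] ∧ LinearIndependent ℂ ![c, d] ∧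
      edgeCurve C₁ C₂ = zeroLocus (edgeForm a b c d) := by
  obtain ⟨A, hA⟩ := C₁.exists_hasMatrix
  obtain ⟨B, hB⟩ := C₂.exists_hasMatrix
  obtain ⟨M, hM, h₁, h₂⟩ := exists_normalizing_matrix hA hB h
  exact ⟨_, _, _, _, edgeCurve_eq hA hB hM h₁ h₂⟩

/-! ### Types that do not occur -/

theorem eq_sum_X_of_isHomogeneous {σ : Type*} [Fintype σ] {p : MvPolynomial σ ℂ}
    (hp : p.IsHomogeneous 1) : p = ∑ i, C (p.coeff (Finsupp.single i 1)) * X i := by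
  classical
  ext d
  by_cases hd : d.degree = 1
  · obtain ⟨i, rfl⟩ := (Finsupp.sum_eq_one_iff d).1 hd
    simp [coeff_sum, coeff_C_mul, coeff_X, Finsupp.single_left_inj]
  · rw [hp.coeff_eq_zero hd]
    refine (IsHomogeneous.coeff_eq_zero (n := 1) (IsHomogeneous.sum _ _ _ fun i _ ↦ ?_) hd).symm
    exact (isHomogeneous_X ℂ i).C_mul _

theorem exists_eq_linear_inl {H : BiPoly} (hH : IsBihomogeneous H 1 0) :
    ∃ x y : ℂ, H = C x * X (Sum.inl 0) + C y * X (Sum.inl 1) := by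
  have h := eq_sum_X_of_isHomogeneous hH.isHomogeneous
  have h0 : ∀ i : Fin 2, H.coeff (Finsupp.single (Sum.inr i) 1) = 0 := fun i ↦
    hH.2.coeff_eq_zero _ (by simp [Finsupp.weight_single])
  simp only [Fintype.sum_sum_type, h0, C_0, zero_mul, Finset.sum_const_zero, add_zero,
    Fin.sum_univ_two] at h
  exact ⟨_, _, h⟩

/-- A binary quadratic form with two given distinct roots is a multiple of the product of the
corresponding linear forms. -/
theorem not_linearIndependent_of_two_zeros {a b : Fin 3 → ℂ} {x y x' y' : ℂ}
    (hD : x * y' - x' * y ≠ 0)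
    (ha : eval ![y, -x] (quad a) = 0) (ha' : eval ![y', -x'] (quad a) = 0)
    (hb : eval ![y, -x] (quad b) = 0) (hb' : eval ![y', -x'] (quad b) = 0) :
    ¬ LinearIndependent ℂ ![a, b] := by
  simp only [eval_quad, Matrix.cons_val_zero, Matrix.cons_val_one] at ha ha' hb hb'
  -- The multiplier is, up to sign, twice the polar form of `e` at the two roots; the vector on the
  -- right holds the coefficients of the product of the two linear forms.
  have key : ∀ e : Fin 3 → ℂ, e 0 * y ^ 2 + e 1 * (y * -x) + e 2 * (-x) ^ 2 = 0 →
      e 0 * y' ^ 2 + e 1 * (y' * -x') + e 2 * (-x') ^ 2 = 0 →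
      (x * y' - x' * y) ^ 2 • e =
        -(2 * e 0 * y * y' - e 1 * (x * y' + x' * y) + 2 * e 2 * x * x') •
          ![x * x', x * y' + x' * y, y * y'] := by
    intro e h h'
    ext i
    fin_cases i <;> simp
    · linear_combination x' ^ 2 * h + x ^ 2 * h'
    · linear_combination (2 * x' * y') * h + (2 * x * y) * h'
    · linear_combination y' ^ 2 * h + y ^ 2 * h'
  have h1 := key a ha ha'
  have h2 := key b hb hb'
  set r := 2 * a 0 * y * y' - a 1 * (x * y' + x' * y) + 2 * a 2 * x * x'
  set s := 2 * b 0 * y * y' - b 1 * (x * y' + x' * y) + 2 * b 2 * x * x'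
  intro h
  have hD2 := pow_ne_zero 2 hD
  have h3 : s • a + (-r) • b = 0 := by
    refine (smul_eq_zero.1 ?_).resolve_left hD2
    rw [smul_add, smul_comm _ s, smul_comm _ (-r), h1, h2, smul_smul, smul_smul, ← add_smul]
    convert zero_smul ℂ _
    ring
  have hr : r = 0 := by simpa using (LinearIndependent.pair_iff.1 h _ _ h3).2
  rw [hr, neg_zero, zero_smul] at h1
  exact h.ne_zero 0 ((smul_eq_zero.1 h1).resolve_left hD2)

/-- Along a line `{p} × ℙ¹` the form `a(p) d - b(p) c` vanishes identically, so `a(p) = b(p) = 0`.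
The two `(1,0)`-lines alone give the contradiction. -/
theorem not_fourLines {a b c d : Fin 3 → ℂ} (h₁ : LinearIndependent ℂ ![a, b])
    (h₂ : LinearIndependent ℂ ![c, d]) : ¬ IsCurveOfType (zeroLocus (edgeForm a b c d))
      .fourLines := by
  rintro ⟨F, hF, hZ, H₁, H₂, K₁, K₂, hH₁, hH₂, -, -, hH, -, hFe⟩
  obtain ⟨x, y, rfl⟩ := exists_eq_linear_inl hH₁.1
  obtain ⟨x', y', rfl⟩ := exists_eq_linear_inl hH₂.1
  have key : ∀ v : Fin 2 → ℂ, (∀ w, eval (Sum.elim v w) F = 0) →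
      eval v (quad a) = 0 ∧ eval v (quad b) = 0 := by
    intro v hv
    refine eq_zero_of_forall_eval h₂ fun w ↦ ?_
    rw [← eval_edgeForm]
    exact eval_eq_zero_of_zeroLocus_subset hF (isBihomogeneous_edgeForm a b c d) hZ.subset _ (hv w)
  -- `D = 0` would make the two linear forms proportional, hence associated.
  by_cases hD : x * y' - x' * y = 0
  · refine hH (hH₂.2.associated_of_dvd hH₁.2 ?_).symm
    by_cases hx' : x' = 0
    · have hy' : y' ≠ 0 := by
        rintro rfl
        exact hH₂.2.ne_zero (by simp [hx'])
      have hx : x = 0 := by simpa [hx', hy'] using hD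
      refine ⟨C (y / y'), ?_⟩
      rw [hx, hx', C_0, zero_mul, zero_add, zero_add, mul_right_comm, ← C_mul,
        mul_div_cancel₀ _ hy']
    · refine ⟨C (x / x'), ?_⟩
      have hy : y = y' * (x / x') := by
        field_simp
        linear_combination -hD
      rw [add_mul, mul_right_comm, ← C_mul, mul_div_cancel₀ _ hx', mul_right_comm, ← C_mul, ← hy]
  · have h := key ![y, -x] fun w ↦ by simp [hFe]; left; left; ring
    have h' := key ![y', -x'] fun w ↦ by simp [hFe]; left; right; ring
    exact not_linearIndependent_of_two_zeros hD h.1 h'.1 h.2 h'.2 h₁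

/-! ### The cuspidal type -/

theorem edgeForm_smul (r : ℂ) (a b c d : Fin 3 → ℂ) :
    edgeForm (r • a) (r • b) c d = C r * edgeForm a b c d := by
  simp only [edgeForm, map_smul, smul_eq_C_mul, map_mul, rename_C]
  ring

/-- The type is witnessed by an equation known only through its zero locus. Being irreducible, it
divides the edge form; both have total degree 4, so the quotient is a constant, absorbed into `a`
and `b`. -/
theorem exists_eq_edgeForm_of_irreducible {F : BiPoly} (hF : IsBihomogeneous F 2 2)
    (hirr : Irreducible F) {a b c d : Fin 3 → ℂ} (h0 : edgeForm a b c d ≠ 0)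
    (hZ : zeroLocus F = zeroLocus (edgeForm a b c d)) : ∃ a' b', F = edgeForm a' b' c d := by
  obtain ⟨k, hk⟩ : F ∣ edgeForm a b c d := dvd_of_forall_eval_eq_zero hirr
    (eval_eq_zero_of_zeroLocus_subset hF (isBihomogeneous_edgeForm a b c d) hZ.subset)
  have hk0 : k ≠ 0 := right_ne_zero_of_mul (hk ▸ h0)
  have hdeg := congrArg totalDegree hk
  rw [totalDegree_mul_of_isDomain hirr.ne_zero hk0, hF.isHomogeneous.totalDegree hirr.ne_zero,
    (isBihomogeneous_edgeForm a b c d).isHomogeneous.totalDegree h0] at hdeg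
  have hkC := totalDegree_eq_zero_iff_eq_C.1 (show k.totalDegree = 0 by lia)
  set r := k.coeff 0
  have hr : r ≠ 0 := by
    rintro hr
    exact hk0 (by rw [hkC, hr, C_0])
  refine ⟨r⁻¹ • a, r⁻¹ • b, ?_⟩
  rw [edgeForm_smul, hk, hkC, mul_comm F, ← mul_assoc, ← C_mul, inv_mul_cancel₀ hr, C_1, one_mul]

theorem homogeneousComponent_eq {σ : Type*} {g : ℕ → MvPolynomial σ ℂ}
    (hg : ∀ i, (g i).IsHomogeneous i) {N n : ℕ} (hn : n < N) :
    (∑ i ∈ Finset.range N, g i).homogeneousComponent n = g n := by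
  rw [map_sum, Finset.sum_eq_single n]
  · rw [homogeneousComponent_of_mem (hg n), if_pos rfl]
  · intro i _ hi
    rw [homogeneousComponent_of_mem (hg i), if_neg hi.symm]
  · simp [hn]

/-- The homogeneous parts of `∑ m i j x ^ i y ^ j`, for `i, j ≤ 2`. -/
noncomputable def biquadraticPart (m : Fin 3 → Fin 3 → ℂ) : ℕ → MvPolynomial (Fin 2) ℂ
  | 0 => C (m 0 0)
  | 1 => C (m 1 0) * X 0 + C (m 0 1) * X 1
  | 2 => C (m 2 0) * X 0 ^ 2 + C (m 1 1) * (X 0 * X 1) + C (m 0 2) * X 1 ^ 2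
  | 3 => C (m 2 1) * (X 0 ^ 2 * X 1) + C (m 1 2) * (X 0 * X 1 ^ 2)
  | 4 => C (m 2 2) * (X 0 ^ 2 * X 1 ^ 2)
  | _ => 0

theorem isHomogeneous_biquadraticPart (m : Fin 3 → Fin 3 → ℂ) (n : ℕ) :
    (biquadraticPart m n).IsHomogeneous n := by
  have h0 := isHomogeneous_X ℂ (0 : Fin 2)
  have h1 := isHomogeneous_X ℂ (1 : Fin 2)
  match n with
  | 0 => exact isHomogeneous_C _ _
  | 1 => exact (h0.C_mul _).add (h1.C_mul _)
  | 2 => exact (((h0.pow 2).C_mul _).add ((h0.mul h1).C_mul _)).add ((h1.pow 2).C_mul _)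
  | 3 => exact (((h0.pow 2).mul h1).C_mul _).add ((h0.mul (h1.pow 2)).C_mul _)
  | 4 => exact ((h0.pow 2).mul (h1.pow 2)).C_mul _
  | n + 5 => exact isHomogeneous_zero _ _ _

/-- The coefficients of the quadratic form `q` restricted to the affine line `p + x p'`. -/
def affineCoeff (q : Fin 3 → ℂ) (p p' : Fin 2 → ℂ) : Fin 3 → ℂ :=
  ![q 0 * p 0 ^ 2 + q 1 * (p 0 * p 1) + q 2 * p 1 ^ 2,
    2 * q 0 * p 0 * p' 0 + q 1 * (p 0 * p' 1 + p' 0 * p 1) + 2 * q 2 * p 1 * p' 1,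
    q 0 * p' 0 ^ 2 + q 1 * (p' 0 * p' 1) + q 2 * p' 1 ^ 2]

theorem aeval_quad_affine (a : Fin 3 → ℂ) (p p' : Fin 2 → ℂ) (k : Fin 2) :
    aeval (fun i ↦ C (p i) + C (p' i) * X k : Fin 2 → MvPolynomial (Fin 2) ℂ) (quad a) =
      C (affineCoeff a p p' 0) + C (affineCoeff a p p' 1) * X k +
        C (affineCoeff a p p' 2) * X k ^ 2 := by
  have h2 : (C 2 : MvPolynomial (Fin 2) ℂ) = 2 := map_ofNat C 2
  simp only [quad_apply, affineCoeff, Matrix.cons_val_zero, Matrix.cons_val_one, Matrix.cons_val,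
    map_add, map_mul, map_pow, aeval_X, aeval_C, algebraMap_eq, h2]
  ring

theorem localEquation_edgeForm (a b c d : Fin 3 → ℂ) (p p' q q' : Fin 2 → ℂ) :
    localEquation (edgeForm a b c d) p p' q q' = ∑ n ∈ Finset.range 5,
      biquadraticPart (fun i j ↦ affineCoeff a p p' i * affineCoeff d q q' j -
        affineCoeff b p p' i * affineCoeff c q q' j) n := by
  rw [localEquation, edgeForm, map_sub, map_mul, map_mul, aeval_rename, aeval_rename, aeval_rename,
    aeval_rename, Sum.elim_comp_inl, Sum.elim_comp_inr]
  simp only [aeval_quad_affine, Finset.sum_range_succ, Finset.sum_range_zero, biquadraticPart,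
    C_sub, C_mul]
  ring

theorem not_cuspidal {a b c d : Fin 3 → ℂ} (h₁ : LinearIndependent ℂ ![a, b])
    (h₂ : LinearIndependent ℂ ![c, d]) :
    ¬ IsCurveOfType (zeroLocus (edgeForm a b c d)) .cuspidal := by
  rintro ⟨F, hF, hZ, hirr, P, g, ⟨p', q', -, -, hg⟩, hg0, hg1, L, hL, hL0, hg2, hg3⟩
  obtain ⟨a, b, rfl⟩ := exists_eq_edgeForm_of_irreducible hF hirr (edgeForm_ne_zero h₁ h₂) hZ
  rw [localEquation_edgeForm] at hg
  set m : Fin 3 → Fin 3 → ℂ := fun i j ↦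
    affineCoeff a P.1.rep p' i * affineCoeff d P.2.rep q' j -
      affineCoeff b P.1.rep p' i * affineCoeff c P.2.rep q' j with hm
  -- `m` is a difference of two rank-one matrices, so its rank is at most 2.
  have hdet : m 0 0 * (m 1 1 * m 2 2 - m 1 2 * m 2 1) - m 0 1 * (m 1 0 * m 2 2 - m 1 2 * m 2 0) +
      m 0 2 * (m 1 0 * m 2 1 - m 1 1 * m 2 0) = 0 := by
    simp only [hm]
    ring
  clear_value m
  have hh := isHomogeneous_biquadraticPart m
  rw [hg, homogeneousComponent_eq hh (by simp)] at hg0 hg1 hg2 hg3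
  have e0 := congrArg (eval 0) hg0
  have e1 := congrArg (eval ![1, 0]) hg1
  have e2 := congrArg (eval ![0, 1]) hg1
  simp [biquadraticPart] at e0 e1 e2
  have hL' := eq_sum_X_of_isHomogeneous hL
  rw [Fin.sum_univ_two] at hL'
  set x := L.coeff (Finsupp.single 0 1)
  set y := L.coeff (Finsupp.single 1 1)
  clear_value x y
  subst hL'
  have f0 := congrArg (eval ![1, 0]) hg2
  have f1 := congrArg (eval ![0, 1]) hg2
  have f2 := congrArg (eval ![1, 1]) hg2
  simp [biquadraticPart] at f0 f1 f2
  have f3 : m 1 1 = 2 * x * y := by linear_combination f2 - f0 - f1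
  -- With `m₀₀ = m₁₀ = m₀₁ = 0` and quadratic part `(xX₀ + yX₁)²`, the determinant reduces to
  -- `-2(xy)³`.
  have hxy : x * y = 0 := by
    rw [e0, e1, e2, f0, f1, f3] at hdet
    have : (x * y) ^ 3 = 0 := by linear_combination (-1 / 2 : ℂ) * hdet
    exact pow_eq_zero_iff (by simp) |>.1 this
  refine hg3 ?_
  -- Degree at most 2 in each variable excludes pure cubes, so both axes divide the cubic part, and
  -- `L` is now one of them up to a scalar.
  have h3 : biquadraticPart m 3 = X 0 * (X 1 * (C (m 2 1) * X 0 + C (m 1 2) * X 1)) := by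
    simp only [biquadraticPart]
    ring
  rw [h3]
  rcases mul_eq_zero.1 hxy with rfl | rfl
  · have hy : y ≠ 0 := by rintro rfl; simp at hL0
    rw [C_0, zero_mul, zero_add, ((isUnit_iff_ne_zero.2 hy).map C).mul_left_dvd]
    exact (dvd_mul_right _ _).mul_left _
  · have hx : x ≠ 0 := by rintro rfl; simp at hL0
    rw [C_0, zero_mul, add_zero, ((isUnit_iff_ne_zero.2 hx).map C).mul_left_dvd]
    exact dvd_mul_right _ _

/-! ### Types that occur -/

/-- A zero row is inserted at index 3 for the first conic and index 2 for the second, so the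
coordinates are already normalized and `edgeCurve_eq` applies with `M = 1`. -/
theorem exists_conics {T U : Fin 3 → Fin 3 → ℂ} (hT : (Matrix.of T).det ≠ 0)
    (hU : (Matrix.of U).det ≠ 0) : ∃ C₁ C₂ : Conic, C₁.plane ≠ C₂.plane ∧
      edgeCurve C₁ C₂ = zeroLocus (edgeForm (jac (T 0) (T 2)) (jac (T 1) (T 2))
        (jac (U 0) (U 2)) (jac (U 1) (U 2))) := by
  have hspan : ∀ {V : Fin 3 → Fin 3 → ℂ}, (Matrix.of V).det ≠ 0 → ∀ {A : Fin 4 → Fin 3 → ℂ},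
      (∀ i, V i ∈ Set.range A) → Submodule.span ℂ (Set.range A) = ⊤ := by
    intro V hV A hVA
    have hli : LinearIndependent ℂ V :=
      (Matrix.linearIndependent_rows_iff_isUnit (A := Matrix.of V)).2
        ((Matrix.isUnit_iff_isUnit_det _).2 (isUnit_iff_ne_zero.2 hV))
    rw [eq_top_iff, ← hli.span_eq_top_of_card_eq_finrank (by simp)]
    exact Submodule.span_mono (Set.range_subset_iff.2 hVA)
  set A : Fin 4 → Fin 3 → ℂ := ![T 0, T 1, T 2, 0] with hA
  set B : Fin 4 → Fin 3 → ℂ := ![U 0, U 1, 0, U 2] with hB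
  have hAs := hspan hT (A := A) (by
    intro i; fin_cases i <;> [exact ⟨0, rfl⟩; exact ⟨1, rfl⟩; exact ⟨2, rfl⟩])
  have hBs := hspan hU (A := B) (by
    intro i; fin_cases i <;> [exact ⟨0, rfl⟩; exact ⟨1, rfl⟩; exact ⟨3, rfl⟩])
  have hA' : (conicOfRows A hAs).HasMatrix (Matrix.of A) := fun i ↦ rfl
  have hB' : (conicOfRows B hBs).HasMatrix (Matrix.of B) := fun i ↦ rfl
  refine ⟨conicOfRows A hAs, conicOfRows B hBs, ?_, ?_⟩
  · rw [hA'.plane_eq, hB'.plane_eq]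
    intro h
    have hU2 : U 2 = 0 := by
      refine dotProduct_eq_zero _ fun w ↦ ?_
      have hw : (Matrix.of B).mulVec w ∈ LinearMap.range (Matrix.of B).mulVecLin := ⟨w, rfl⟩
      rw [← h] at hw
      obtain ⟨x, hx⟩ := hw
      have h3 : (0 : Fin 3 → ℂ) ⬝ᵥ x = U 2 ⬝ᵥ w := congrFun hx 3
      rw [← h3, zero_dotProduct]
    exact hU (Matrix.det_eq_zero_of_row_eq_zero 2 (congrFun hU2))
  · have := (edgeCurve_eq hA' hB' (M := 1) (by simp) (by rw [Matrix.one_mul]; rfl)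
      (by rw [Matrix.one_mul]; rfl)).2.2
    simp only [Matrix.one_mul] at this
    exact this

theorem occurs_of_edgeForm_eq {τ : CurveType} {T U : Fin 3 → Fin 3 → ℂ}
    (hT : (Matrix.of T).det ≠ 0) (hU : (Matrix.of U).det ≠ 0) {F : BiPoly} {r : ℂ} (hr : r ≠ 0)
    (hF : edgeForm (jac (T 0) (T 2)) (jac (T 1) (T 2)) (jac (U 0) (U 2)) (jac (U 1) (U 2)) =
      C r * F) (h : HasType F τ) :
    ∃ C₁ C₂ : Conic, C₁.plane ≠ C₂.plane ∧ IsCurveOfType (edgeCurve C₁ C₂) τ := by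
  obtain ⟨C₁, C₂, hne, hE⟩ := exists_conics hT hU
  refine ⟨C₁, C₂, hne, F, ?_, ?_, h⟩
  · have := (isBihomogeneous_edgeForm (jac (T 0) (T 2)) (jac (T 1) (T 2)) (jac (U 0) (U 2))
      (jac (U 1) (U 2))).C_mul r⁻¹
    rwa [hF, ← mul_assoc, ← C_mul, inv_mul_cancel₀ hr, C_1, one_mul] at this
  · rw [hE, hF]
    ext P
    simp [zeroLocus, evalAt, hr]

/-! ### Points of the projective line -/

theorem mk_eq_mk_iff_cross {v w : Fin 2 → ℂ} (hv : v ≠ 0) (hw : w ≠ 0) :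
    (Projectivization.mk ℂ v hv = Projectivization.mk ℂ w hw) ↔ v 0 * w 1 = v 1 * w 0 := by
  rw [Projectivization.mk_eq_mk_iff']
  constructor
  · rintro ⟨a, rfl⟩
    simp only [Pi.smul_apply, smul_eq_mul]
    ring
  · intro h
    by_cases hw0 : w 0 = 0
    · have hw1 : w 1 ≠ 0 := fun hw1 ↦ hw (by ext i; fin_cases i <;> assumption)
      refine ⟨v 1 / w 1, ?_⟩
      have hv0 : v 0 = 0 := by simpa [hw0, hw1] using h
      ext i
      fin_cases i <;> simp [hw0, hv0, hw1]
    · refine ⟨v 0 / w 0, ?_⟩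
      ext i
      fin_cases i
      · simp [hw0]
      · simp
        field_simp
        linear_combination h

theorem eq_mk_iff_cross {P : P1} {w : Fin 2 → ℂ} (hw : w ≠ 0) :
    P = Projectivization.mk ℂ w hw ↔ P.rep 0 * w 1 = P.rep 1 * w 0 := by
  conv_lhs => rw [← P.mk_rep]
  exact mk_eq_mk_iff_cross _ _

theorem rep_zero_or_one_ne_zero (P : P1) : P.rep 0 ≠ 0 ∨ P.rep 1 ≠ 0 := by
  by_contra! h
  exact P.rep_nonzero (by ext i; fin_cases i <;> simp [h])

/-- The point `[x : y]`. -/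
noncomputable def pt (x y : ℂ) (h : ![x, y] ≠ 0) : P1 := Projectivization.mk ℂ ![x, y] h

theorem eq_pt_iff {P : P1} {x y : ℂ} {h : ![x, y] ≠ 0} :
    P = pt x y h ↔ P.rep 0 * y = P.rep 1 * x := eq_mk_iff_cross h

theorem pt_eq_pt_iff {x y x' y' : ℂ} {h : ![x, y] ≠ 0} {h' : ![x', y'] ≠ 0} :
    pt x y h = pt x' y' h' ↔ x * y' = y * x' := mk_eq_mk_iff_cross h h'

section Irreducibility

variable {σ : Type*} {p q : MvPolynomial σ ℂ} {i j : σ}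

theorem notMem_vars_mul (hp : i ∉ p.vars) (hq : i ∉ q.vars) : i ∉ (p * q).vars := by
  classical
  exact fun h ↦ (Finset.mem_union.1 (vars_mul p q h)).elim hp hq

theorem notMem_vars_pow (hp : i ∉ p.vars) (n : ℕ) : i ∉ (p ^ n).vars := by
  classical
  exact fun h ↦ hp (vars_pow p n h)

theorem notMem_vars_neg (hp : i ∉ p.vars) : i ∉ (-p).vars := by
  rwa [vars_neg]

theorem notMem_vars_sub (hp : i ∉ p.vars) (hq : i ∉ q.vars) : i ∉ (p - q).vars := by
  classical
  exact fun h ↦ (Finset.mem_union.1 (vars_sub_subset p h)).elim hp hq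

theorem notMem_vars_X (h : i ≠ j) : i ∉ (X j : MvPolynomial σ ℂ).vars := by
  simpa [vars_X] using h

theorem isRelPrime_X (x : σ → ℂ) (hx : x i = 0) (hp : eval x p ≠ 0) : IsRelPrime (X i) p := by
  rw [X_prime.irreducible.isRelPrime_iff_not_dvd]
  rintro ⟨q, rfl⟩
  simp [hx] at hp

/-- Eisenstein at `π`; coprimality of `α` and `β` supplies primitivity. -/
theorem irreducible_quadratic {R : Type*} [CommRing R] [IsDomain R] {π α β : R} (hπ : Prime π)
    (hα : ¬ π ∣ α) (hβ : π ∣ β) (hβ' : ¬ π ^ 2 ∣ β) (h : IsRelPrime α β) :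
    Irreducible (Polynomial.C α * Polynomial.X ^ 2 + Polynomial.C β) := by
  have hα0 : α ≠ 0 := by
    rintro rfl
    simp at hα
  have e : Polynomial.C α * Polynomial.X ^ 2 + Polynomial.C β =
      Polynomial.C α * Polynomial.X ^ 2 + Polynomial.C 0 * Polynomial.X + Polynomial.C β := by simp
  have hdeg := Polynomial.degree_quadratic (b := 0) (c := β) hα0
  have hlead := Polynomial.leadingCoeff_quadratic (b := 0) (c := β) hα0
  rw [← e] at hdeg hlead
  have h0 : (Polynomial.C α * Polynomial.X ^ 2 + Polynomial.C β).coeff 0 = β := by simp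
  have h1 : (Polynomial.C α * Polynomial.X ^ 2 + Polynomial.C β).coeff 1 = 0 := by
    simp [Polynomial.coeff_X_pow]
  have h2 : (Polynomial.C α * Polynomial.X ^ 2 + Polynomial.C β).coeff 2 = α := by
    simp
  refine Polynomial.irreducible_of_eisenstein_criterion (P := Ideal.span {π})
    ((Ideal.span_singleton_prime hπ.ne_zero).2 hπ) ?_ ?_ ?_ ?_ ?_
  · rwa [hlead, Ideal.mem_span_singleton]
  · intro n hn
    rw [hdeg] at hn
    have : n < 2 := by exact_mod_cast hn
    interval_cases n
    · rwa [h0, Ideal.mem_span_singleton]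
    · rw [h1]
      exact Ideal.zero_mem _
  · rw [hdeg]
    norm_num
  · rwa [h0, Ideal.span_singleton_pow, Ideal.mem_span_singleton]
  · intro r hr
    rw [Polynomial.C_dvd_iff_dvd_coeff] at hr
    exact h (h2 ▸ hr 2) (h0 ▸ hr 0)

end Irreducibility

/-! ### Explicit examples -/

theorem occurs_smooth : ∃ C₁ C₂ : Conic, C₁.plane ≠ C₂.plane ∧
    IsCurveOfType (edgeCurve C₁ C₂) .smooth := by
  -- Here `[a : b] = [s² : t²]` and `[c : d] = [u² + v² : u² - v²]`. The branch values `[1 : 0], [0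
  -- : 1]` and `[1 : 1], [1 : -1]` are disjoint, which makes the fibre product smooth.
  refine occurs_of_edgeForm_eq (T := ![![1, 0, 0], ![0, 0, -1], ![0, 1, 0]])
    (U := ![![1, 0, -1], ![1, 0, 1], ![0, 1, 0]]) (by simp [Matrix.det_fin_three])
    (by simp [Matrix.det_fin_three]) one_ne_zero
    (F := X (.inl 0) ^ 2 * (X (.inr 0) ^ 2 - X (.inr 1) ^ 2) -
      X (.inl 1) ^ 2 * (X (.inr 0) ^ 2 + X (.inr 1) ^ 2)) ?_ ?_
  · simp [edgeForm, quad_apply, jac]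
    ring
  · rintro P ⟨-, h⟩
    have h0 := h (.inl 0)
    have h1 := h (.inl 1)
    have h2 := h (.inr 0)
    have h3 := h (.inr 1)
    simp [evalAt, pderiv_X] at h0 h1 h2 h3
    have hp := rep_zero_or_one_ne_zero P.1
    have hq := rep_zero_or_one_ne_zero P.2
    generalize P.1.rep = p at *
    generalize P.2.rep = q at *
    grind

/-- As a polynomial in `s` the form is `u² s² + t² (u - v)(u + v)`, which is Eisenstein at `u - v`.
-/
theorem irreducible_nodal : Irreducible
    (edgeForm ![1, 0, 0] ![0, 0, 1] ![-1, 0, 1] ![1, 0, 0]) := by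
  let e : BiPoly ≃ₐ[ℂ] Polynomial (MvPolynomial (Fin 3) ℂ) :=
    (renameEquiv ℂ (finSumFinEquiv (m := 2) (n := 2))).trans (finSuccEquiv ℂ 3)
  have he : ∀ k, e (X k) = finSuccEquiv ℂ 3 (X (finSumFinEquiv (m := 2) (n := 2) k)) := fun k ↦ by
    simp [e]
  have h0 : e (X (.inl 0)) = Polynomial.X := by
    rw [he, show finSumFinEquiv (m := 2) (n := 2) (.inl 0) = 0 by decide, finSuccEquiv_X_zero]
  have h1 : e (X (.inl 1)) = Polynomial.C (X 0) := by
    rw [he, show finSumFinEquiv (m := 2) (n := 2) (.inl 1) = Fin.succ 0 by decide,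
      finSuccEquiv_X_succ]
  have h2 : e (X (.inr 0)) = Polynomial.C (X 1) := by
    rw [he, show finSumFinEquiv (m := 2) (n := 2) (.inr 0) = Fin.succ 1 by decide,
      finSuccEquiv_X_succ]
  have h3 : e (X (.inr 1)) = Polynomial.C (X 2) := by
    rw [he, show finSumFinEquiv (m := 2) (n := 2) (.inr 1) = Fin.succ 2 by decide,
      finSuccEquiv_X_succ]
  have hF : edgeForm ![1, 0, 0] ![0, 0, 1] ![-1, 0, 1] ![1, 0, 0] =
      X (.inl 0) ^ 2 * X (.inr 0) ^ 2 -
        X (.inl 1) ^ 2 * (X (.inr 1) ^ 2 - X (.inr 0) ^ 2) := by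
    simp [edgeForm, quad_apply]
    ring
  have heF : e (edgeForm ![1, 0, 0] ![0, 0, 1] ![-1, 0, 1] ![1, 0, 0]) =
      Polynomial.C (X 1 ^ 2) * Polynomial.X ^ 2 +
        Polynomial.C ((X 1 + -X 2) * (X 0 ^ 2 * (X 1 + X 2))) := by
    rw [hF]
    simp only [map_sub, map_mul, map_pow, h0, h1, h2, h3, map_add, map_neg]
    ring
  rw [← MulEquiv.irreducible_iff e, heF]
  have hπ : Irreducible (X 1 + -X 2 : MvPolynomial (Fin 3) ℂ) := by
    have := irreducible_mul_X_add (1 : MvPolynomial (Fin 3) ℂ) (-X 2) 1 one_ne_zero (by simp)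
      (notMem_vars_neg (notMem_vars_X (by decide))) isRelPrime_one_left
    rwa [one_mul] at this
  -- The prime vanishes at the point `(1, 1, 1)`, so it divides nothing that is nonzero there.
  have hnd : ∀ p : MvPolynomial (Fin 3) ℂ, eval 1 p ≠ 0 → ¬ (X 1 + -X 2) ∣ p := by
    rintro _ hp ⟨q, rfl⟩
    simp at hp
  refine irreducible_quadratic hπ.prime (hnd _ (by simp)) (dvd_mul_right _ _) ?_ ?_
  · rw [pow_two, mul_dvd_mul_iff_left hπ.ne_zero]
    exact hnd _ (by simp)
  · refine (isRelPrime_X ![1, 0, 1] ?_ ?_).pow_left <;> simp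

/-- The maps `[s² : t²]` and `[v² - u² : u²]` share exactly one branch value, `[1 : 0]`; the node
lies over it, at `t = u = 0`. -/
theorem hasType_nodal : HasType (edgeForm ![1, 0, 0] ![0, 0, 1] ![-1, 0, 1] ![1, 0, 0])
    .nodal := by
  refine ⟨irreducible_nodal, (pt 1 0 (by simp), pt 0 1 (by simp)), ?_, ?_⟩
  · have hp1 : (pt 1 0 (by simp)).rep 1 = 0 := by
      simpa using (eq_pt_iff.1 (rfl : pt 1 0 (by simp) = pt 1 0 (by simp))).symm
    have hq0 : (pt 0 1 (by simp)).rep 0 = 0 := by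
      simpa using eq_pt_iff.1 (rfl : pt 0 1 (by simp) = pt 0 1 (by simp))
    have hp0 := (rep_zero_or_one_ne_zero (pt 1 0 (by simp))).resolve_right (not_not.2 hp1)
    have hq1 := (rep_zero_or_one_ne_zero (pt 0 1 (by simp))).resolve_left (not_not.2 hq0)
    refine ⟨_, ⟨![0, 1], ![1, 0], ?_, ?_, rfl⟩, ?_⟩
    · rw [LinearIndependent.pair_iff]
      intro s t h
      have h0 := congrFun h 0
      have h1 := congrFun h 1
      simp [hp1, hp0] at h0 h1
      exact ⟨h0, h1⟩
    · rw [LinearIndependent.pair_iff]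
      intro s t h
      have h0 := congrFun h 0
      have h1 := congrFun h 1
      simp [hq0, hq1] at h0 h1
      exact ⟨h1, h0⟩
    · dsimp only
      generalize (pt 1 0 (by simp)).rep = p at *
      generalize (pt 0 1 (by simp)).rep = q at *
      rw [localEquation_edgeForm,
        homogeneousComponent_eq (isHomogeneous_biquadraticPart _) (by simp),
        homogeneousComponent_eq (isHomogeneous_biquadraticPart _) (by simp),
        homogeneousComponent_eq (isHomogeneous_biquadraticPart _) (by simp)]
      refine ⟨?_, ?_, C (p 0) * X 1 - C (q 1) * X 0, C (p 0) * X 1 + C (q 1) * X 0,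
        ((isHomogeneous_X ℂ 1).C_mul _).sub ((isHomogeneous_X ℂ 0).C_mul _),
        ((isHomogeneous_X ℂ 1).C_mul _).add ((isHomogeneous_X ℂ 0).C_mul _), ?_, ?_⟩
      · simp [biquadraticPart, affineCoeff, hp1, hq0]
      · simp [biquadraticPart, affineCoeff, hp1, hq0]
      · rw [LinearIndependent.pair_iff]
        intro s t h
        have h0 := congrArg (eval ![1, 0]) h
        have h1 := congrArg (eval ![0, 1]) h
        simp [smul_eval] at h0 h1
        grind
      · simp [biquadraticPart, affineCoeff, hp1, hq0]
        ring
  · rintro Q ⟨-, h⟩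
    have h0 := h (.inl 0)
    have h1 := h (.inl 1)
    have h2 := h (.inr 0)
    have h3 := h (.inr 1)
    simp [evalAt, pderiv_X, edgeForm, quad_apply] at h0 h1 h2 h3
    have hp := rep_zero_or_one_ne_zero Q.1
    have hq := rep_zero_or_one_ne_zero Q.2
    simp only [Prod.ext_iff, eq_pt_iff]
    generalize Q.1.rep = p at *
    generalize Q.2.rep = q at *
    grind

theorem occurs_nodal : ∃ C₁ C₂ : Conic, C₁.plane ≠ C₂.plane ∧
    IsCurveOfType (edgeCurve C₁ C₂) .nodal := by
  refine occurs_of_edgeForm_eq (T := ![![1, 0, 0], ![0, 0, -1], ![0, 1, 0]])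
    (U := ![![-1, 0, -1], ![1, 0, 0], ![0, 1, 0]]) (by simp [Matrix.det_fin_three])
    (by simp [Matrix.det_fin_three]) one_ne_zero ?_ hasType_nodal
  simp [jac]

/-- The form `s uᵢ + r t uⱼ` of bidegree `(1,1)`. -/
noncomputable def twisted (i j : Fin 2) (r : ℂ) : BiPoly :=
  X (.inl 0) * X (.inr i) + C r * (X (.inl 1) * X (.inr j))

theorem irreducible_twisted {i j : Fin 2} (hij : i ≠ j) {r : ℂ} (hr : r ≠ 0) :
    Irreducible (twisted i j r) := by
  have h1 : Sum.inr i ∉ (X (.inl 0) : BiPoly).vars := notMem_vars_X (by simp)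
  have h2 : Sum.inr i ∉ (C r * (X (.inl 1) * X (.inr j)) : BiPoly).vars :=
    notMem_vars_mul (by simp) (notMem_vars_mul (notMem_vars_X (by simp))
      (notMem_vars_X (by simpa)))
  have h3 : IsRelPrime (X (.inl 0)) (C r * (X (.inl 1) * X (.inr j)) : BiPoly) := by
    refine isRelPrime_X (Sum.elim ![0, 1] ![1, 1]) ?_ ?_
    · simp
    · fin_cases j <;> simpa
  exact irreducible_mul_X_add _ _ _ (X_ne_zero _) h1 h2 h3

theorem isIrreducibleCurve_twisted {i j : Fin 2} (hij : i ≠ j) {r : ℂ} (hr : r ≠ 0) :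
    IsIrreducibleCurve (twisted i j r) 1 1 :=
  ⟨((isBihomogeneous_inl 0).mul (isBihomogeneous_inr i)).add
    (((isBihomogeneous_inl 1).mul (isBihomogeneous_inr j)).C_mul r), irreducible_twisted hij hr⟩

theorem occurs_twoConics : ∃ C₁ C₂ : Conic, C₁.plane ≠ C₂.plane ∧
    IsCurveOfType (edgeCurve C₁ C₂) .twoConics := by
  -- Both maps are squaring, so both branch values are shared and `s²v² - t²u²` splits.
  refine occurs_of_edgeForm_eq (T := ![![1, 0, 0], ![0, 0, -1], ![0, 1, 0]])
    (U := ![![1, 0, 0], ![0, 0, -1], ![0, 1, 0]]) (by simp [Matrix.det_fin_three])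
    (by simp [Matrix.det_fin_three]) one_ne_zero ?_
    ⟨twisted 1 0 1, twisted 1 0 (-1), isIrreducibleCurve_twisted (by simp) (by simp),
      isIrreducibleCurve_twisted (by simp) (by simp), rfl, ?_⟩
  · simp [edgeForm, quad_apply, jac, twisted]
    ring
  · have : zeroLocus (twisted 1 0 1) ∩ zeroLocus (twisted 1 0 (-1)) =
        {(pt 1 0 (by simp), pt 1 0 (by simp)), (pt 0 1 (by simp), pt 0 1 (by simp))} := by
      ext P
      have hp := rep_zero_or_one_ne_zero P.1
      have hq := rep_zero_or_one_ne_zero P.2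
      simp [zeroLocus, evalAt, Prod.ext_iff, eq_pt_iff, twisted]
      generalize P.1.rep = p at *
      generalize P.2.rep = q at *
      grind
    rw [this, Set.encard_pair]
    simp [pt_eq_pt_iff]

theorem isIrreducibleCurve_inl (i : Fin 2) : IsIrreducibleCurve (X (.inl i)) 1 0 :=
  ⟨isBihomogeneous_inl i, X_prime.irreducible⟩

theorem isIrreducibleCurve_inr (i : Fin 2) : IsIrreducibleCurve (X (.inr i)) 0 1 :=
  ⟨isBihomogeneous_inr i, X_prime.irreducible⟩

theorem occurs_cubicSecant : ∃ C₁ C₂ : Conic, C₁.plane ≠ C₂.plane ∧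
    IsCurveOfType (edgeCurve C₁ C₂) .cubicSecant := by
  have key : ∀ G : BiPoly, G = -X (.inl 1) ^ 2 * X (.inr 0) +
      (X (.inl 0) ^ 2 - X (.inl 1) ^ 2) * X (.inr 1) →
      IsIrreducibleCurve G 2 1 ∧ (zeroLocus G ∩ zeroLocus (X (.inr 0))).encard = 2 := by
    rintro _ rfl
    refine ⟨⟨?_, ?_⟩, ?_⟩
    · exact (((isBihomogeneous_inl 1).pow 2).neg.mul (isBihomogeneous_inr 0)).add
        ((((isBihomogeneous_inl 0).pow 2).sub ((isBihomogeneous_inl 1).pow 2)).mul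
          (isBihomogeneous_inr 1))
    · refine irreducible_mul_X_add _ _ _ (by simp) (notMem_vars_neg (notMem_vars_pow
        (notMem_vars_X (by simp)) _)) (notMem_vars_mul (notMem_vars_sub (notMem_vars_pow
        (notMem_vars_X (by simp)) _) (notMem_vars_pow (notMem_vars_X (by simp)) _))
        (notMem_vars_X (by simp))) ?_
      rw [IsRelPrime.neg_left_iff]
      exact (isRelPrime_X (Sum.elim ![1, 0] ![1, 1]) (by simp) (by simp)).pow_left
    · have : zeroLocus (-X (.inl 1) ^ 2 * X (.inr 0) +
          (X (.inl 0) ^ 2 - X (.inl 1) ^ 2) * X (.inr 1)) ∩ zeroLocus (X (.inr 0)) =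
          {(pt 1 1 (by simp), pt 0 1 (by simp)), (pt 1 (-1) (by simp), pt 0 1 (by simp))} := by
        ext P
        have hp := rep_zero_or_one_ne_zero P.1
        have hq := rep_zero_or_one_ne_zero P.2
        simp [zeroLocus, evalAt, Prod.ext_iff, eq_pt_iff]
        generalize P.1.rep = p at *
        generalize P.2.rep = q at *
        grind
      rw [this, Set.encard_pair]
      simp [pt_eq_pt_iff]
      norm_num
  obtain ⟨h₁, h₂⟩ := key _ rfl
  -- The second conic touches `ℓ`, so `c`, `d` share the factor `u`. The residual map `[u + v : v]`
  -- takes the value `[1 : 1]` at `u = 0`, not a branch value of `[s² : t²]`: two intersection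
  -- points.
  refine occurs_of_edgeForm_eq (T := ![![1, 0, 0], ![0, 0, -1], ![0, 1, 0]])
    (U := ![![0, 2, 1], ![0, 0, 1], ![1, 0, 0]]) (r := -2) (by simp [Matrix.det_fin_three])
    (by simp [Matrix.det_fin_three]) (by simp) ?_
    ⟨_, X (.inr 0), h₁, isIrreducibleCurve_inr 0, rfl, h₂⟩
  have h2 : (C 2 : BiPoly) = 2 := map_ofNat C 2
  simp [edgeForm, quad_apply, jac, h2]
  ring

theorem occurs_cubicTangent : ∃ C₁ C₂ : Conic, C₁.plane ≠ C₂.plane ∧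
    IsCurveOfType (edgeCurve C₁ C₂) .cubicTangent := by
  have key : ∀ G : BiPoly, G = X (.inl 0) ^ 2 * X (.inr 0) + -(X (.inl 1) ^ 2 * X (.inr 1)) →
      IsIrreducibleCurve G 2 1 ∧ (zeroLocus G ∩ zeroLocus (X (.inr 0))).encard = 1 := by
    rintro _ rfl
    refine ⟨⟨?_, ?_⟩, ?_⟩
    · exact (((isBihomogeneous_inl 0).pow 2).mul (isBihomogeneous_inr 0)).add
        (((isBihomogeneous_inl 1).pow 2).mul (isBihomogeneous_inr 1)).neg
    · exact irreducible_mul_X_add _ _ _ (by simp) (notMem_vars_pow (notMem_vars_X (by simp)) _)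
        (notMem_vars_neg (notMem_vars_mul (notMem_vars_pow (notMem_vars_X (by simp)) _)
        (notMem_vars_X (by simp))))
        (isRelPrime_X (Sum.elim ![0, 1] ![1, 1]) (by simp) (by simp)).pow_left
    · rw [Set.encard_eq_one]
      refine ⟨(pt 1 0 (by simp), pt 0 1 (by simp)), ?_⟩
      ext P
      have hp := rep_zero_or_one_ne_zero P.1
      have hq := rep_zero_or_one_ne_zero P.2
      simp [zeroLocus, evalAt, Prod.ext_iff, eq_pt_iff]
      generalize P.1.rep = p at *
      generalize P.2.rep = q at *
      grind
  obtain ⟨h₁, h₂⟩ := key _ rfl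
  -- Now the residual map is `[v : u]`, whose value `[1 : 0]` at `u = 0` is a branch value of `[s² :
  -- t²]`: tangency.
  refine occurs_of_edgeForm_eq (T := ![![1, 0, 0], ![0, 0, -1], ![0, 1, 0]])
    (U := ![![0, 0, 1], ![0, 2, 0], ![1, 0, 0]]) (r := -2) (by simp [Matrix.det_fin_three])
    (by simp [Matrix.det_fin_three]) (by simp) ?_
    ⟨_, X (.inr 0), h₁, isIrreducibleCurve_inr 0, rfl, h₂⟩
  have h2 : (C 2 : BiPoly) = 2 := map_ofNat C 2
  simp [edgeForm, quad_apply, jac, h2]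
  ring

theorem occurs_triangle : ∃ C₁ C₂ : Conic, C₁.plane ≠ C₂.plane ∧
    IsCurveOfType (edgeCurve C₁ C₂) .triangle := by
  -- Both conics touch `ℓ`, with residual maps `[s : t]` and `[v : u]`. Their values at the base
  -- points, `[0 : 1]` and `[1 : 0]`, differ, so the three components have no common point.
  refine occurs_of_edgeForm_eq (T := ![![0, 2, 0], ![0, 0, 1], ![1, 0, 0]])
    (U := ![![0, 0, 1], ![0, 2, 0], ![1, 0, 0]]) (r := 4) (by simp [Matrix.det_fin_three])
    (by simp [Matrix.det_fin_three]) (by simp) ?_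
    ⟨twisted 0 1 (-1), X (.inr 0), X (.inl 0),
      isIrreducibleCurve_twisted (by simp) (by simp),
      isIrreducibleCurve_inr 0, isIrreducibleCurve_inl 0, rfl, ?_⟩
  · have h2 : (C 2 : BiPoly) = 2 := map_ofNat C 2
    have h4 : (C 4 : BiPoly) = 4 := map_ofNat C 4
    simp [edgeForm, quad_apply, jac, h2, h4, twisted]
    ring
  · refine Set.eq_empty_of_forall_notMem ?_
    rintro P ⟨⟨h1, h2⟩, h3⟩
    have hp := rep_zero_or_one_ne_zero P.1
    have hq := rep_zero_or_one_ne_zero P.2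
    simp [zeroLocus, evalAt, twisted] at h1 h2 h3
    simp_all

theorem occurs_concurrent : ∃ C₁ C₂ : Conic, C₁.plane ≠ C₂.plane ∧
    IsCurveOfType (edgeCurve C₁ C₂) .concurrent := by
  -- With `T = U` the residual maps `[s : t]` and `[u : v]` agree at the base points, so the
  -- `(1,1)`-curve passes through the intersection of the lines.
  refine occurs_of_edgeForm_eq (T := ![![0, 2, 0], ![0, 0, 1], ![1, 0, 0]])
    (U := ![![0, 2, 0], ![0, 0, 1], ![1, 0, 0]]) (r := 4) (by simp [Matrix.det_fin_three])
    (by simp [Matrix.det_fin_three]) (by simp) ?_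
    ⟨twisted 1 0 (-1), X (.inr 0), X (.inl 0),
      isIrreducibleCurve_twisted (by simp) (by simp),
      isIrreducibleCurve_inr 0, isIrreducibleCurve_inl 0, rfl,
      (pt 0 1 (by simp), pt 0 1 (by simp)), ?_⟩
  · have h2 : (C 2 : BiPoly) = 2 := map_ofNat C 2
    have h4 : (C 4 : BiPoly) = 4 := map_ofNat C 4
    simp [edgeForm, quad_apply, jac, h2, h4, twisted]
    ring
  · have h0 : (pt 0 1 (by simp)).rep 0 = 0 := by
      simpa using eq_pt_iff.1 (rfl : pt 0 1 (by simp) = pt 0 1 (by simp))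
    simp [zeroLocus, evalAt, h0, twisted]

end EdgeCurves

theorem mainTheorem5 (τ : EdgeCurves.CurveType) :
    (∃ C₁ C₂ : EdgeCurves.Conic, C₁.plane ≠ C₂.plane ∧
      EdgeCurves.IsCurveOfType (EdgeCurves.edgeCurve C₁ C₂) τ) ↔
    τ ≠ EdgeCurves.CurveType.cuspidal ∧ τ ≠ EdgeCurves.CurveType.fourLines := by
  constructor
  · rintro ⟨C₁, C₂, hne, hE⟩
    obtain ⟨a, b, c, d, h₁, h₂, h⟩ := EdgeCurves.exists_edgeForm C₁ C₂ hne
    rw [h] at hE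
    constructor <;> rintro rfl
    · exact EdgeCurves.not_cuspidal h₁ h₂ hE
    · exact EdgeCurves.not_fourLines h₁ h₂ hE
  · rintro ⟨h₁, h₂⟩
    cases τ
    · exact EdgeCurves.occurs_smooth
    · exact EdgeCurves.occurs_nodal
    · exact absurd rfl h₁
    · exact absurd rfl h₂
    · exact EdgeCurves.occurs_twoConics
    · exact EdgeCurves.occurs_cubicSecant
    · exact EdgeCurves.occurs_cubicTangent
    · exact EdgeCurves.occurs_triangle
    · exact EdgeCurves.occurs_concurrent
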